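/- **Notation.** Let $\mathrm{sgn}(t)=1$ if $t\ge 0$ and $-1$ otherwise, $a\wedge b=\min\{a,b\}$, $1/\infty=0$, and, for $t>0$, $t^\infty=0,1,\infty$ according as $t<1$, $t=1$, $t>1$. For a Borel probability measure $P$ on $[0,1]^d\times\{-1,1\}$ let $P_X$ be its marginal on $[0,1]^d$, $\eta_P(x)=P(\{1\}\mid x)$ (regular conditional probability), $\mathcal R_P(f)=P(\{(x,y):\mathrm{sgn}(f(x))\ne y\})$, and $\mathcal E_P(f)=\mathcal R_P(f)-\inf_g\mathcal R_P(g)$, the infimum being over all Borel measurable $g:[0,1]^d\to\mathbb R$. For $\beta,r>0$ and $p=\lceil\beta\rceil-1$, let $\mathcal B^\beta_r([0,1]^{m})$ be the set of continuous $g:[0,1]^m\to\mathbb R$ that are $p$ times continuously differentiable on $(0,1)^m$, with all partial derivatives of order at most $p$ uniformly continuous there, and such that $$\max_{|u|\le p}\ \sup_{x\in(0,1)^m}|D^ug(x)|+\max_{|u|=p}\ \sup_{x\ne z\in(0,1)^m}\frac{|D^ug(x)-D^ug(z)|}{\|x-z\|_2^{\beta-p}}\le r .$$ For positive integers $m,d_\star,d_*$,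 let $\mathcal G_m$ be the set of functions $f:[0,1]^m\to\mathbb R$ for which either $f(x)=g((x)_I)$ for all $x$, for some $I\subset\{1,\dots,m\}$ with $\#I=d_*$ and some $g\in\mathcal B^\beta_r([0,1]^{d_*})$, where $(x)_I$ is the subvector of the coordinates in $I$ in increasing order; or $f(x)=\max_{i\in I}(x)_i$ for all $x$, for some $I\subset\{1,\dots,m\}$ with $1\le\#I\le d_\star$. Let $\mathcal G^{\mathbf{CHOM}}=\mathcal G_d^{\mathbf{CHOM}}(q,K,d_\star,d_*,\beta,r)$ be the set of all $h_q\circ\cdots\circ h_1\circ h_0$ where $h_0$ is defined on $[0,1]^d$, $h_i$ is defined on $[0,1]^K$ for $0<i\le q$, $h_i$ takes values in $[0,1]^K$ for $0\le i<q$, $h_q$ is real-valued, all component functions of $h_0$ belong to $\mathcal G_d$, and all component functions of $h_i$, $0<i\le q$, belong to $\mathcal G_K$. Let $\mathcal H$ be the set of all Borel probability measures $P$ on $[0,1]^d\times\{-1,1\}$ such that $\eta_P=f$ holds $P_X$-almost surely for some $f\in\mathcal G^{\mathbf{CHOM}}$, and let $\mathcal T^{s}_{\alpha,\tau}$ be the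 set of those $P$ satisfying the Tsybakov noise condition $$P_X\big(\{x:|2\eta_P(x)-1|\le t\}\big)\le\alpha\, t^s\quad\text{for all real } t \text{ with } 0<t\le\tau .$$ **Theorem 3.3.** Let $d,K,d_\star,d_*\ge1$ and $q\ge0$ be integers, $\beta,r,\alpha\in(0,\infty)$ and $\tau\in(0,\infty]$. Suppose that $d_*\le d$, that $d_*q\le Kq$, and that it is not the case that both $\alpha<1$ and $\tau\ge1$. Then there is a constant $C\in(0,\infty)$ depending only on $(d,q,K,d_\star,d_*,\beta,r,\tau,\alpha)$ such that for every integer $n\ge1$ and every $s\in[0,\infty]$ there is an estimator $\hat f_n^{\lozenge}$, based on an i.i.d. sample $(X_i,Y_i)_{i=1}^n$ from $P$ and jointly Borel measurable in the sample and in $x\in[0,1]^d$, with $$\boldsymbol E_{P^{\otimes n}}\big[\mathcal E_P(\hat f_n^{\lozenge})\big]\le C\cdot\Big(\frac1n\Big)^{\frac{\beta(1\wedge\beta)^q}{\frac{d_*}{s+1}+\left(1+\frac1{s+1}\right)\beta(1\wedge\beta)^q}}\qquad\text{for all }P\in\mathcal H\cap\mathcal T^{s}_{\alpha,\tau}.$$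 Moreover, $\hat f_n^{\lozenge}$ can be taken to be an empirical hinge risk minimizer: there is a finite $\mathcal W\subset\mathcal G^{\mathbf{CHOM}}$ that is a $\xi$-net of $\mathcal G^{\mathbf{CHOM}}$ in the uniform norm, with $\xi=\frac{\tau\wedge1}{3}\,n^{-1/(s+2+d_*/(\beta(1\wedge\beta)^q))}$, such that, for every sample, $\hat f_n^{\lozenge}$ minimizes $\frac1n\sum_{i=1}^n\max\{0,1-Y_if(X_i)\}$ over $f\in\{\mathrm{sgn}(2w-1):w\in\mathcal W\}$. -/

import Mathlib

open MeasureTheory ProbabilityTheory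
open scoped ENNReal

noncomputable section

namespace CompClassif

/-- The unit cube `[0,1]^d`, as a type (with its Borel σ-algebra). -/
abbrev Cube (d : ℕ) : Type := ↥(Set.Icc (0 : Fin d → ℝ) 1)

/-- The label space `{-1, 1}`. -/
abbrev Label : Type := ↥({-1, 1} : Set ℝ)

/-- The label `1`. -/
def Label.one : Label := ⟨1, by simp⟩

/-- The sign function with the convention `sgn 0 = 1`. -/
def sgn (t : ℝ) : ℝ := if 0 ≤ t then 1 else -1

/-! ### Hölder balls -/

/-- The iterated partial derivative `∂_{i 0} ∂_{i 1} ⋯ ∂_{i (k-1)} f` at `x`. For `k`-times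
continuously differentiable functions the order of differentiation is irrelevant, so when `i` runs
over all tuples of length `k`, these are exactly the derivatives `D^u f` with `u` running over
the multi-indices of total degree `k`. -/
def pderiv {m k : ℕ} (i : Fin k → Fin m) (f : (Fin m → ℝ) → ℝ) (x : Fin m → ℝ) : ℝ :=
  iteratedFDeriv ℝ k f x (fun j => Pi.single (i j) (1 : ℝ))

/-- `f` restricted to the closed domain `E` belongs to `C^k(E)`: `f` is continuous on `E`, `k` times
continuously differentiable in the interior of `E`, and all its partial derivatives of order at
most `k` are uniformly continuous there. -/
def IsCk {m : ℕ} (k : ℕ) (E : Set (Fin m → ℝ)) (f : (Fin m → ℝ) → ℝ) : Prop :=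
  ContinuousOn f E ∧ ContDiffOn ℝ (k : ℕ∞) f (interior E) ∧
    ∀ j ≤ k, ∀ i : Fin j → Fin m, UniformContinuousOn (pderiv i f) (interior E)

/-- The Hölder-`β` norm on `E`, with values in `[0,∞]`. The integer `⌈β - 1⌉` is the largest one
strictly below `β`, and the Hölder exponent `β - ⌈β - 1⌉` lies in `(0,1]`. Increments are
measured in the Euclidean norm. -/
def holderNorm {m : ℕ} (β : ℝ) (E : Set (Fin m → ℝ)) (f : (Fin m → ℝ) → ℝ) : ℝ≥0∞ :=
  (⨆ (k : ℕ) (_ : (k : ℝ) < β) (i : Fin k → Fin m) (x ∈ interior E),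
      ENNReal.ofReal |pderiv i f x|) +
    ⨆ (i : Fin ⌈β - 1⌉₊ → Fin m) (x ∈ interior E) (z ∈ interior E) (_ : x ≠ z),
      ENNReal.ofReal
        (|pderiv i f x - pderiv i f z| / ‖WithLp.toLp 2 (x - z)‖ ^ (β - (⌈β - 1⌉₊ : ℝ)))

/-- The Hölder ball of radius `r` on `E`. Only the values on `E` matter. -/
def holderBall {m : ℕ} (β r : ℝ) (E : Set (Fin m → ℝ)) : Set ((Fin m → ℝ) → ℝ) :=
  {f | IsCk ⌈β - 1⌉₊ E f ∧ holderNorm β E f ≤ ENNReal.ofReal r}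

/-! ### Compositional functions -/

/-- Functions on `[0,1]^d` of the form `x ↦ g (x_I)` with `I` a set of `ds` coordinates (listed in
increasing order) and `g` in the Hölder ball of radius `r` on `[0,1]^ds`. -/
def classH (d ds : ℕ) (β r : ℝ) : Set (Cube d → ℝ) :=
  {f | ∃ (I : Finset (Fin d)) (hI : I.card = ds),
    ∃ g ∈ holderBall β r (Set.Icc (0 : Fin ds → ℝ) 1),
      ∀ x : Cube d, f x = g (fun j => x.1 (I.orderEmbOfFin hI j))}

/-- Functions on `[0,1]^d` computing the maximum of at least one and at most `dM` coordinates. -/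
def classM (d dM : ℕ) : Set (Cube d → ℝ) :=
  {f | ∃ (I : Finset (Fin d)) (hI : I.Nonempty), I.card ≤ dM ∧
    ∀ x : Cube d, f x = I.sup' hI (fun i => x.1 i)}

/-- The class of compositions `h_q ∘ ⋯ ∘ h_0` with `h_0 : [0,1]^d → [0,1]^K`,
`h_i : [0,1]^K → [0,1]^K` for `0 < i < q`, `h_q` real-valued (with `h_0 = h_q : [0,1]^d → ℝ` when
`q = 0`), all component functions belonging to `classH ∪ classM`. -/
def classCHOM (K dM ds : ℕ) (β r : ℝ) : (q d : ℕ) → Set (Cube d → ℝ)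
  | 0, d => classH d ds β r ∪ classM d dM
  | q + 1, d =>
    {f | ∃ h : Cube d → Cube K,
      (∀ j : Fin K, (fun x => (h x).1 j) ∈ classH d ds β r ∪ classM d dM) ∧
      ∃ g ∈ classCHOM K dM ds β r q K, f = g ∘ h}

/-! ### Distributions -/

/-- The conditional class probability `η_P(x) = P({1} | x)`, from the regular conditional
distribution of the label given the input. -/
def ccp {d : ℕ} (P : ProbabilityMeasure (Cube d × Label)) (x : Cube d) : ℝ :=
  ((P : Measure (Cube d × Label)).condKernel x).real {Label.one}

/-- The distributions whose conditional class probability agrees, almost surely with respect to the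
input marginal, with a compositional function. -/
def compModel (d q K dM ds : ℕ) (β r : ℝ) : Set (ProbabilityMeasure (Cube d × Label)) :=
  {P | ∃ f ∈ classCHOM K dM ds β r q d,
    ∀ᵐ x ∂(P : Measure (Cube d × Label)).fst, ccp P x = f x}

/-- `t ^ s` for `t > 0` and `s ∈ [0,∞]`, where `t ^ ∞` is `0` if `t < 1`, `1` if `t = 1`, and `∞`
if `t > 1`. -/
def extPow (t : ℝ) (s : ℝ≥0∞) : ℝ≥0∞ :=
  if s = ∞ then (if t < 1 then 0 else if t = 1 then 1 else ∞) else ENNReal.ofReal (t ^ s.toReal)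

/-- The distributions satisfying the Tsybakov noise condition
`P_X (|2 η_P - 1| ≤ t) ≤ α * t ^ s` for all real `t` with `0 < t ≤ τ`. -/
def noiseModel (d : ℕ) (s : ℝ≥0∞) (α : ℝ) (τ : ℝ≥0∞) :
    Set (ProbabilityMeasure (Cube d × Label)) :=
  {P | ∀ t : ℝ, 0 < t → ENNReal.ofReal t ≤ τ →
    (P : Measure (Cube d × Label)).fst {x | |2 * ccp P x - 1| ≤ t}
      ≤ ENNReal.ofReal α * extPow t s}

/-! ### Risks and estimators -/

/-- The 0-1 risk (misclassification error). -/
def risk {d : ℕ} (P : ProbabilityMeasure (Cube d × Label)) (f : Cube d → ℝ) : ℝ :=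
  (P : Measure (Cube d × Label)).real {z | sgn (f z.1) ≠ z.2.1}

/-- The excess 0-1 risk, relative to all Borel measurable functions. -/
def excessRisk {d : ℕ} (P : ProbabilityMeasure (Cube d × Label)) (f : Cube d → ℝ) : ℝ :=
  risk P f - ⨅ g : {g : Cube d → ℝ // Measurable g}, risk P g.1

/-- The hinge loss. -/
def hinge (t : ℝ) : ℝ := max 0 (1 - t)

/-- The empirical hinge risk of `f` on the sample `D`. -/
def empHingeRisk {d n : ℕ} (D : Fin n → Cube d × Label) (f : Cube d → ℝ) : ℝ :=
  (1 / (n : ℝ)) * ∑ i, hinge ((D i).2.1 * f (D i).1)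

/-- `fhat` is an empirical hinge risk minimizer over the class `F`. -/
def IsHingeERM {d n : ℕ} (F : Set (Cube d → ℝ))
    (fhat : (Fin n → Cube d × Label) → Cube d → ℝ) : Prop :=
  ∀ D, fhat D ∈ F ∧ ∀ g ∈ F, empHingeRisk D (fhat D) ≤ empHingeRisk D g

/-- `W` is a finite `ξ`-net of `G` in the uniform norm, with centers in `G`. -/
def IsFiniteNet {d : ℕ} (W G : Set (Cube d → ℝ)) (ξ : ℝ) : Prop :=
  W.Finite ∧ W ⊆ G ∧ ∀ f ∈ G, ∃ g ∈ W, ∀ x, |f x - g x| ≤ ξ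

/-- The plug-in classifiers `x ↦ sgn (2 f(x) - 1)`, `f ∈ W`. -/
def plugIn {d : ℕ} (W : Set (Cube d → ℝ)) : Set (Cube d → ℝ) :=
  (fun f x => sgn (2 * f x - 1)) '' W

/-! ### Exponents -/

/-- The effective smoothness `β (1 ∧ β)^q`. -/
def effSmooth (β : ℝ) (q : ℕ) : ℝ := β * (min 1 β) ^ q

/-- `β (1 ∧ β)^q / (ds / (s + 1) + (1 + 1 / (s + 1)) β (1 ∧ β)^q)`, where `1 / (s + 1) = 0` for
`s = ∞`. -/
def rateExp (β : ℝ) (q ds : ℕ) (s : ℝ≥0∞) : ℝ :=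
  effSmooth β q /
    (ds * ((s + 1)⁻¹).toReal + (1 + ((s + 1)⁻¹).toReal) * effSmooth β q)

/-- The net width `((τ ∧ 1) / 3) (1 / n)^{1 / (s + 2 + ds / (β (1 ∧ β)^q))}`, where the exponent
is `0` for `s = ∞`. -/
def netWidth (β : ℝ) (q ds : ℕ) (s τ : ℝ≥0∞) (n : ℕ) : ℝ :=
  (min τ 1).toReal / 3 *
    (1 / (n : ℝ)) ^ ((s + 2 + ENNReal.ofReal (ds / effSmooth β q))⁻¹).toReal

end CompClassif

end

noncomputable section

namespace CompClassif

section HolderBall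

/-! ### Quantization in finite-dimensional spaces -/

section Quantization

variable {E : Type} [NormedAddCommGroup E] [NormedSpace ℝ E] [FiniteDimensional ℝ E]

/-! Write b = ds / (β (1 ∧ β)^q). The argument has three ingredients.

Entropy: the compositional class splits into exp(C ε^(-b)) sets of uniform diameter ε. A Hölder ball
is partitioned by dyadic refinement (`exists_holderBall_partition`): inside a cell found at scale
2h, the rescaled local Taylor polynomials vary in a bounded set, so boundedly many labels per cube
of side h suffice and no logarithm is lost. Compositions follow by induction
(`exists_classCHOM_partition`): an outer function made of k layers transmits an inner error to the
power (1 ∧ β)^k, and maxima contribute only finitely many functions.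

Fast rates: for ±1-valued functions the hinge loss is twice the 0-1 loss, so the estimator minimizes
the empirical 0-1 risk. An exponential-moment bound (`integral_erm_le`) controls E[λe − λ²v] for the
selected rule, where e is its excess risk and v its probability of disagreeing with the Bayes rule.
The noise condition at margin 2ξ bounds v by e / (2ξ) plus the mass a of {|2η − 1| ≤ 2ξ}
(`mul_disagree_le`), so at λ = ξ half of the linear term survives. A net element ξ-close to η
differs from the Bayes rule only on that set, so its excess risk is at most 2ξa. Together
(`integral_excessRisk_le`) the expected excess risk is at most 6ξa + 2 log N / (ξn).

Balance: a ≤ α(2ξ)^s and log N ≤ C ξ^(-b), so ξ of order n^(-1/(s+2+b)) equates ξ^(s+1) with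
ξ^(-b-1)/n, and both have the order of the rate. For s = ∞ the width is constant, the first term
vanishes and the second is of order 1/n. -/

theorem exists_finset_cover_two :
    ∃ s : Finset E, s.card ≤ 5 ^ Module.finrank ℝ E ∧ ∀ u : E, ‖u‖ ≤ 2 → ∃ c ∈ s, ‖u - c‖ ≤ 1 := by
  classical
  -- A 1-separated subset of the ball of maximal cardinality is a 1-net: an uncovered point could be
  -- added to it.
  let p : ℕ → Prop := fun k => ∃ s : Finset E, s.card = k ∧ (∀ c ∈ s, ‖c‖ ≤ 2) ∧
    ∀ c ∈ s, ∀ d ∈ s, c ≠ d → 1 ≤ ‖c - d‖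
  have h0 : p 0 := ⟨∅, by simp⟩
  have hb : ∀ k, p k → k ≤ 5 ^ Module.finrank ℝ E := by
    rintro k ⟨s, rfl, h1, h2⟩
    exact Besicovitch.card_le_of_separated s h1 h2
  obtain ⟨s, hs, h1, h2⟩ := Nat.findGreatest_spec (P := p) (Nat.zero_le _) h0
  refine ⟨s, hs ▸ Nat.findGreatest_le _, fun u hu => ?_⟩
  by_contra! hcon
  have hus : u ∉ s := fun h => by
    have := hcon u h
    rw [sub_self, norm_zero] at this
    linarith
  have hp : p (s.card + 1) := by
    refine ⟨insert u s, Finset.card_insert_of_notMem hus, ?_, ?_⟩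
    · intro c hc
      rcases Finset.mem_insert.1 hc with rfl | hc
      exacts [hu, h1 c hc]
    · intro c hc d hd hcd
      rcases Finset.mem_insert.1 hc with hcu | hcs <;>
        rcases Finset.mem_insert.1 hd with hdu | hds
      · exact absurd (hcu.trans hdu.symm) hcd
      · rw [hcu]; exact (hcon d hds).le
      · rw [hdu, norm_sub_rev]; exact (hcon c hcs).le
      · exact h2 c hcs d hds hcd
  have := Nat.le_findGreatest (hb _ hp) hp
  omega

/-- Subtracting a suitable scaled point of the radius-2 net halves the norm bound, so each doubling
of the radius costs one factor `5 ^ finrank`. -/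
theorem exists_finset_cover_pow (k : ℕ) :
    ∃ s : Finset E, s.card ≤ (5 ^ Module.finrank ℝ E) ^ k ∧
      ∀ u : E, ‖u‖ ≤ 2 ^ k / 2 → ∃ c ∈ s, ‖u - c‖ ≤ 1 / 2 := by
  classical
  induction k with
  | zero => exact ⟨{0}, by simp, fun u hu => ⟨0, by simp, by simpa using hu⟩⟩
  | succ k ih =>
    obtain ⟨s, hs, hs'⟩ := ih
    obtain ⟨t, ht, ht'⟩ := exists_finset_cover_two (E := E)
    refine ⟨Finset.image₂ (fun a b => a + (2 ^ k / 2 : ℝ) • b) s t,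
      (Finset.card_image₂_le _ _ _).trans ?_, fun u hu => ?_⟩
    · rw [pow_succ]; gcongr
    · have hk : (0 : ℝ) < 2 ^ k / 2 := by positivity
      obtain ⟨b, hb, hub⟩ := ht' ((2 ^ k / 2 : ℝ)⁻¹ • u) (by
        rw [norm_smul, norm_inv, Real.norm_of_nonneg hk.le, inv_mul_le_iff₀ hk]
        refine hu.trans_eq ?_
        rw [pow_succ]; ring)
      have hub' : ‖u - (2 ^ k / 2 : ℝ) • b‖ ≤ 2 ^ k / 2 := by
        have : u - (2 ^ k / 2 : ℝ) • b = (2 ^ k / 2 : ℝ) • ((2 ^ k / 2 : ℝ)⁻¹ • u - b) := by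
          rw [smul_sub, smul_inv_smul₀ hk.ne']
        rw [this, norm_smul, Real.norm_of_nonneg hk.le]
        exact mul_le_of_le_one_right hk.le hub
      obtain ⟨a, ha, hua⟩ := hs' _ hub'
      refine ⟨_, Finset.mem_image₂_of_mem ha hb, ?_⟩
      rwa [← sub_sub, sub_right_comm]

end Quantization

/-- A ball in a finite-dimensional normed space can be partitioned into a number of sets of diameter
at most one that depends only on the radius and on the dimension. -/
theorem exists_quantizer (D : ℕ) (A : ℝ) : ∃ M : ℕ, ∀ (E : Type) [NormedAddCommGroup E]
    [NormedSpace ℝ E] [FiniteDimensional ℝ E], Module.finrank ℝ E ≤ D →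
    ∃ φ : E → Fin M, ∀ u v, ‖u‖ ≤ A → ‖v‖ ≤ A → φ u = φ v → ‖u - v‖ ≤ 1 := by
  classical
  obtain ⟨k, hk⟩ := pow_unbounded_of_one_lt (2 * A) (by norm_num : (1 : ℝ) < 2)
  -- The additional label is a default for vectors far from every centre; it never occurs on the
  -- ball of radius `A`.
  refine ⟨(5 ^ D) ^ k + 1, fun E _ _ _ hE => ?_⟩
  obtain ⟨s, hs, hs'⟩ := exists_finset_cover_pow (E := E) k
  have hcard : Fintype.card (Option s) ≤ Fintype.card (Fin ((5 ^ D) ^ k + 1)) := by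
    simp only [Fintype.card_option, Fintype.card_coe, Fintype.card_fin]
    gcongr
    exact hs.trans (by gcongr; norm_num)
  obtain ⟨e⟩ := Function.Embedding.nonempty_of_card_le hcard
  have hA : ∀ u : E, ‖u‖ ≤ A → ∃ c ∈ s, ‖u - c‖ ≤ 1 / 2 := fun u hu => hs' u (by linarith)
  refine ⟨fun u => e (if h : ∃ c ∈ s, ‖u - c‖ ≤ 1 / 2 then some ⟨h.choose, h.choose_spec.1⟩
    else none), fun u v hu hv h => ?_⟩
  have h := e.injective h
  rw [dif_pos (hA u hu), dif_pos (hA v hv)] at h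
  simp only [Option.some.injEq, Subtype.mk.injEq] at h
  have h1 := (hA u hu).choose_spec.2
  have h2 := (hA v hv).choose_spec.2
  rw [h] at h1
  calc ‖u - v‖ ≤ ‖u - (hA v hv).choose‖ + ‖v - (hA v hv).choose‖ := by
        rw [norm_sub_rev v]; exact norm_sub_le_norm_sub_add_norm_sub _ _ _
    _ ≤ 1 := by linarith

/-! ### Taylor polynomials of functions in a Hölder ball -/

variable {m : ℕ} {β r : ℝ} {f : (Fin m → ℝ) → ℝ}

theorem abs_pderiv_le (hr : 0 ≤ r) (hf : f ∈ holderBall β r (Set.Icc 0 1)) {k : ℕ}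
    (hk : (k : ℝ) < β) (i : Fin k → Fin m) {x : Fin m → ℝ}
    (hx : x ∈ interior (Set.Icc (0 : Fin m → ℝ) 1)) : |pderiv i f x| ≤ r := by
  have h : ENNReal.ofReal |pderiv i f x| ≤ ENNReal.ofReal r := by
    refine le_trans ?_ hf.2
    refine le_trans ?_ le_self_add
    exact le_iSup₂_of_le k hk (le_iSup_of_le i (le_iSup₂_of_le x hx le_rfl))
  exact (ENNReal.ofReal_le_ofReal_iff hr).1 h

theorem norm_toLp_two_le (x : Fin m → ℝ) : ‖WithLp.toLp 2 x‖ ≤ m * ‖x‖ := by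
  rw [EuclideanSpace.norm_eq]
  refine Real.sqrt_le_iff.2 ⟨by positivity, ?_⟩
  calc ∑ i, ‖x i‖ ^ 2 ≤ ∑ _i : Fin m, ‖x‖ ^ 2 := by
        gcongr with i; exact norm_le_pi_norm x i
    _ = m * ‖x‖ ^ 2 := by simp
    _ ≤ (m * ‖x‖) ^ 2 := by
        rw [mul_pow]
        gcongr
        exact_mod_cast Nat.le_self_pow two_ne_zero m

theorem ceil_sub_one_lt (hβ : 0 < β) : ((⌈β - 1⌉₊ : ℕ) : ℝ) < β := by
  rcases le_or_gt β 1 with h | h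
  · rw [Nat.ceil_eq_zero.2 (by linarith)]; simpa
  · have := Nat.ceil_lt_add_one (a := β - 1) (by linarith)
    linarith

theorem abs_pderiv_sub_le (hβ : 0 < β) (hr : 0 ≤ r) (hf : f ∈ holderBall β r (Set.Icc 0 1))
    (i : Fin ⌈β - 1⌉₊ → Fin m) {x z : Fin m → ℝ}
    (hx : x ∈ interior (Set.Icc (0 : Fin m → ℝ) 1))
    (hz : z ∈ interior (Set.Icc (0 : Fin m → ℝ) 1)) :
    |pderiv i f x - pderiv i f z| ≤ r * (m * ‖x - z‖) ^ (β - (⌈β - 1⌉₊ : ℝ)) := by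
  have hexp : 0 < β - (⌈β - 1⌉₊ : ℝ) := sub_pos.2 (ceil_sub_one_lt hβ)
  rcases eq_or_ne x z with rfl | hxz
  · simp only [sub_self, abs_zero, norm_zero, mul_zero]; positivity
  have hpos : 0 < ‖WithLp.toLp 2 (x - z)‖ := by
    rw [norm_pos_iff]
    simpa [sub_eq_zero] using hxz
  have h : ENNReal.ofReal (|pderiv i f x - pderiv i f z| /
      ‖WithLp.toLp 2 (x - z)‖ ^ (β - (⌈β - 1⌉₊ : ℝ))) ≤ ENNReal.ofReal r := by
    refine le_trans ?_ hf.2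
    refine le_trans ?_ le_add_self
    exact le_iSup_of_le i (le_iSup₂_of_le x hx (le_iSup₂_of_le z hz (le_iSup_of_le hxz le_rfl)))
  have h := (ENNReal.ofReal_le_ofReal_iff hr).1 h
  rw [div_le_iff₀ (by positivity)] at h
  refine h.trans ?_
  gcongr
  exact norm_toLp_two_le _

theorem iteratedFDeriv_apply_eq_sum (k : ℕ) (f : (Fin m → ℝ) → ℝ) (x v : Fin m → ℝ) :
    iteratedFDeriv ℝ k f x (fun _ => v) =
      ∑ i : Fin k → Fin m, pderiv i f x * ∏ j, v (i j) := by
  conv_lhs => rw [show v = ∑ i, v i • Pi.single i (1 : ℝ) from by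
    simpa [eq_comm] using pi_eq_sum_univ' v]
  rw [ContinuousMultilinearMap.map_sum]
  refine Finset.sum_congr rfl fun i _ => ?_
  rw [ContinuousMultilinearMap.map_smul_univ]
  simp [pderiv, mul_comm]

/-- The homogeneous part of degree `k` of the Taylor expansion of `f` around `c`, up to the factor
`1 / k!`. -/
def taylorPart (k : ℕ) (f : (Fin m → ℝ) → ℝ) (c : Fin m → ℝ) : MvPolynomial (Fin m) ℝ :=
  ∑ i : Fin k → Fin m, MvPolynomial.C (pderiv i f c) *
    ∏ j, (MvPolynomial.X (i j) - MvPolynomial.C (c (i j)))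

theorem eval_taylorPart (k : ℕ) (f : (Fin m → ℝ) → ℝ) (c x : Fin m → ℝ) :
    MvPolynomial.eval x (taylorPart k f c) = iteratedFDeriv ℝ k f c (fun _ => x - c) := by
  rw [iteratedFDeriv_apply_eq_sum]
  simp [taylorPart]

theorem totalDegree_taylorPart_le (k : ℕ) (f : (Fin m → ℝ) → ℝ) (c : Fin m → ℝ) :
    (taylorPart k f c).totalDegree ≤ k := by
  refine MvPolynomial.totalDegree_finsetSum_le fun i _ => ?_
  refine (MvPolynomial.totalDegree_mul _ _).trans ?_
  rw [MvPolynomial.totalDegree_C, zero_add]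
  refine (MvPolynomial.totalDegree_finsetProd _ _).trans ?_
  calc _ ≤ ∑ _j : Fin k, 1 := by
        refine Finset.sum_le_sum fun j _ => ?_
        refine (MvPolynomial.totalDegree_sub_C_le _ _).trans ?_
        exact (MvPolynomial.totalDegree_X _).le
    _ = k := by simp

/-- The Taylor polynomial of degree `p` of `f` around `c`. -/
def taylorPoly (p : ℕ) (f : (Fin m → ℝ) → ℝ) (c : Fin m → ℝ) : MvPolynomial (Fin m) ℝ :=
  ∑ k ∈ Finset.range (p + 1), MvPolynomial.C ((k.factorial : ℝ)⁻¹) * taylorPart k f c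

theorem eval_taylorPoly (p : ℕ) (f : (Fin m → ℝ) → ℝ) (c x : Fin m → ℝ) :
    MvPolynomial.eval x (taylorPoly p f c) = ∑ k ∈ Finset.range (p + 1),
      (k.factorial : ℝ)⁻¹ * iteratedFDeriv ℝ k f c (fun _ => x - c) := by
  simp [taylorPoly, eval_taylorPart]

theorem totalDegree_taylorPoly_le (p : ℕ) (f : (Fin m → ℝ) → ℝ) (c : Fin m → ℝ) :
    (taylorPoly p f c).totalDegree ≤ p := by
  refine MvPolynomial.totalDegree_finsetSum_le fun k hk => ?_
  refine (MvPolynomial.totalDegree_mul _ _).trans ?_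
  rw [MvPolynomial.totalDegree_C, zero_add]
  exact (totalDegree_taylorPart_le k f c).trans (Nat.lt_succ_iff.1 (Finset.mem_range.1 hk))

theorem abs_iteratedFDeriv_sub_le (hβ : 0 < β) (hr : 0 ≤ r)
    (hf : f ∈ holderBall β r (Set.Icc 0 1)) {x z : Fin m → ℝ} (v : Fin m → ℝ)
    (hx : x ∈ interior (Set.Icc (0 : Fin m → ℝ) 1))
    (hz : z ∈ interior (Set.Icc (0 : Fin m → ℝ) 1)) :
    |iteratedFDeriv ℝ ⌈β - 1⌉₊ f x (fun _ => v) - iteratedFDeriv ℝ ⌈β - 1⌉₊ f z (fun _ => v)| ≤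
      m ^ ⌈β - 1⌉₊ * ‖v‖ ^ ⌈β - 1⌉₊ * (r * (m * ‖x - z‖) ^ (β - (⌈β - 1⌉₊ : ℝ))) := by
  rw [iteratedFDeriv_apply_eq_sum, iteratedFDeriv_apply_eq_sum, ← Finset.sum_sub_distrib]
  refine (Finset.abs_sum_le_sum_abs _ _).trans ?_
  calc _ ≤ ∑ _i : Fin ⌈β - 1⌉₊ → Fin m,
        (r * (m * ‖x - z‖) ^ (β - (⌈β - 1⌉₊ : ℝ))) * ‖v‖ ^ ⌈β - 1⌉₊ := by
        refine Finset.sum_le_sum fun i _ => ?_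
        rw [← sub_mul, abs_mul]
        gcongr
        · exact abs_pderiv_sub_le hβ hr hf i hx hz
        · rw [Finset.abs_prod]
          calc ∏ j, |v (i j)| ≤ ∏ _j : Fin ⌈β - 1⌉₊, ‖v‖ :=
                Finset.prod_le_prod (fun _ _ => abs_nonneg _) fun j _ => norm_le_pi_norm v (i j)
            _ = _ := by simp
    _ = _ := by simp; ring

/-- In the integral remainder the top-order derivative may be replaced by its increment from `x`,
once the top Taylor term is absorbed. Hölder continuity of that derivative then gives the full order
β without one more derivative. -/
theorem abs_sub_taylorPoly_le (hβ : 0 < β) (hr : 0 ≤ r)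
    (hf : f ∈ holderBall β r (Set.Icc 0 1)) {x z : Fin m → ℝ}
    (hx : x ∈ interior (Set.Icc (0 : Fin m → ℝ) 1))
    (hz : z ∈ interior (Set.Icc (0 : Fin m → ℝ) 1)) :
    |f z - MvPolynomial.eval z (taylorPoly ⌈β - 1⌉₊ f x)| ≤
      m ^ ⌈β - 1⌉₊ * ‖z - x‖ ^ ⌈β - 1⌉₊ *
        (r * (m * ‖z - x‖) ^ (β - (⌈β - 1⌉₊ : ℝ))) := by
  have hexp : 0 < β - (⌈β - 1⌉₊ : ℝ) := sub_pos.2 (ceil_sub_one_lt hβ)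
  have hbound := fun {w : Fin m → ℝ} hw =>
    abs_iteratedFDeriv_sub_le hβ hr hf (x := w) (z := x) (z - x) hw hx
  have hCk := hf.1
  rw [eval_taylorPoly]
  rcases hp : ⌈β - 1⌉₊ with _ | n
  · have h := hbound hz
    rw [hp] at h
    simpa using h
  · rw [hp] at hbound hCk hexp
    set I := interior (Set.Icc (0 : Fin m → ℝ) 1) with hI
    have hopen : IsOpen I := isOpen_interior
    have hconv : Convex ℝ I := (convex_Icc _ _).interior
    have hseg : ∀ t ∈ Set.Icc (0 : ℝ) 1, x + t • (z - x) ∈ I := fun t ht =>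
      hconv.add_smul_sub_mem hx hz ht
    have htaylor := map_add_eq_sum_add_integral_iteratedFDeriv (f := f) (x := x) (y := z - x)
      (n := n) fun t ht => by
        have := hCk.2.1.contDiffAt (hopen.mem_nhds (hseg t ht))
        exact_mod_cast this
    rw [add_sub_cancel] at htaylor
    set φ : ℝ → ℝ := fun t => iteratedFDeriv ℝ (n + 1) f (x + t • (z - x)) fun _ => z - x with hφ
    set B := (m : ℝ) ^ (n + 1) * ‖z - x‖ ^ (n + 1) *
      (r * (m * ‖z - x‖) ^ (β - ((n + 1 : ℕ) : ℝ))) with hB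
    have hφ0 : φ 0 = iteratedFDeriv ℝ (n + 1) f x fun _ => z - x := by simp [hφ]
    have hφB : ∀ t ∈ Set.Icc (0 : ℝ) 1, |φ t - φ 0| ≤ B := fun t ht => by
      rw [hφ0]
      refine (hbound (hseg t ht)).trans ?_
      have : ‖x + t • (z - x) - x‖ ≤ ‖z - x‖ := by
        rw [add_sub_cancel_left, norm_smul, Real.norm_of_nonneg ht.1]
        exact mul_le_of_le_one_left (norm_nonneg _) ht.2
      rw [hB]
      gcongr
    have hφc : ContinuousOn φ (Set.Icc 0 1) := by
      simp only [hφ, iteratedFDeriv_apply_eq_sum]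
      refine continuousOn_finsetSum _ fun i _ => ContinuousOn.mul ?_ continuousOn_const
      exact (hCk.2.2 (n + 1) le_rfl i).continuousOn.comp (by fun_prop) hseg
    have hcu : ContinuousOn φ (Set.uIcc 0 1) := by rwa [Set.uIcc_of_le zero_le_one]
    have hint1 : IntervalIntegrable (fun t => (1 - t) ^ n * φ t) volume 0 1 :=
      (ContinuousOn.mul (by fun_prop) hcu).intervalIntegrable
    have hint2 : IntervalIntegrable (fun t => (1 - t) ^ n * φ 0) volume 0 1 :=
      (Continuous.intervalIntegrable (by fun_prop) _ _)
    have hmom : ∫ t in (0 : ℝ)..1, (1 - t) ^ n * φ 0 = (n + 1 : ℝ)⁻¹ * φ 0 := by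
      rw [intervalIntegral.integral_mul_const,
        intervalIntegral.integral_comp_sub_left (fun t => t ^ n)]
      simp
    -- The weight `(1 - t) ^ n` has integral `1 / (n + 1)`, so the Taylor term of degree `n + 1` is
    -- the integral against the frozen value `φ 0`.
    have hrem : f z - ∑ k ∈ Finset.range (n + 1 + 1),
        (k.factorial : ℝ)⁻¹ * iteratedFDeriv ℝ k f x (fun _ => z - x) =
        (n.factorial : ℝ)⁻¹ * ∫ t in (0 : ℝ)..1, (1 - t) ^ n * (φ t - φ 0) := by
      rw [Finset.sum_range_succ, ← hφ0]
      simp only [mul_sub]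
      rw [intervalIntegral.integral_sub hint1 hint2, hmom, htaylor, Nat.factorial_succ]
      push_cast
      simp only [smul_eq_mul, mul_inv]
      ring
    rw [hrem, abs_mul]
    have h1 : |∫ t in (0 : ℝ)..1, (1 - t) ^ n * (φ t - φ 0)| ≤ B * |(1 : ℝ) - 0| := by
      rw [← Real.norm_eq_abs]
      refine intervalIntegral.norm_integral_le_of_norm_le_const fun t ht => ?_
      rw [Set.uIoc_of_le zero_le_one] at ht
      rw [norm_mul, Real.norm_eq_abs, Real.norm_eq_abs]
      refine (mul_le_of_le_one_left (abs_nonneg _) ?_).trans (hφB t ⟨ht.1.le, ht.2⟩)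
      rw [abs_pow, abs_of_nonneg (by linarith [ht.2])]
      exact pow_le_one₀ (by linarith [ht.2]) (by linarith [ht.1])
    have h2 : |(n.factorial : ℝ)⁻¹| ≤ 1 := by
      rw [abs_of_nonneg (by positivity)]
      exact inv_le_one_of_one_le₀ (by exact_mod_cast n.factorial_pos)
    calc _ ≤ 1 * (B * |(1 : ℝ) - 0|) := by gcongr
      _ = B := by simp

theorem interior_Icc_pi (a b : Fin m → ℝ) :
    interior (Set.Icc a b) = Set.univ.pi fun i => Set.Ioo (a i) (b i) := by
  rw [← Set.pi_univ_Icc, interior_pi_set Set.finite_univ]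
  simp

theorem closure_interior_Icc_pi {a b : Fin m → ℝ} (hab : ∀ i, a i < b i) :
    closure (interior (Set.Icc a b)) = Set.Icc a b := by
  rw [interior_Icc_pi, closure_pi_set, ← Set.pi_univ_Icc]
  simp only [closure_Ioo (hab _).ne]

/-- On a cube of side length `h`, functions in a Hölder ball are polynomials up to an error of the
order `h ^ β`. -/
theorem exists_polynomial_approx (hβ : 0 < β) (hr : 0 ≤ r)
    (hf : f ∈ holderBall β r (Set.Icc 0 1)) {a : Fin m → ℝ} {h : ℝ} (hh : 0 < h)
    (ha : ∀ i, 0 ≤ a i) (ha' : ∀ i, a i + h ≤ 1) :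
    ∃ T ∈ MvPolynomial.restrictTotalDegree (Fin m) ℝ ⌈β - 1⌉₊,
      ∀ x ∈ Set.Icc a (fun i => a i + h), |f x - MvPolynomial.eval x T| ≤
        m ^ ⌈β - 1⌉₊ * (r * (m : ℝ) ^ (β - (⌈β - 1⌉₊ : ℝ))) * h ^ β := by
  have hexp : 0 < β - (⌈β - 1⌉₊ : ℝ) := sub_pos.2 (ceil_sub_one_lt hβ)
  -- The centre lies in the open unit cube even when the subcube touches the boundary, where
  -- derivatives are not controlled; boundary points follow by continuity.
  set c : Fin m → ℝ := fun i => a i + h / 2 with hc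
  have hsub : Set.Icc a (fun i => a i + h) ⊆ Set.Icc 0 1 :=
    Set.Icc_subset_Icc ha ha'
  have hcI : c ∈ interior (Set.Icc a (fun i => a i + h)) := by
    rw [interior_Icc_pi]
    exact fun i _ => ⟨by simp [hc, hh], by simp [hc, hh]⟩
  refine ⟨taylorPoly ⌈β - 1⌉₊ f c, (MvPolynomial.mem_restrictTotalDegree _ _ _).2
    (totalDegree_taylorPoly_le _ _ _), fun x hx => ?_⟩
  have hab : ∀ i, a i < a i + h := fun i => by linarith
  rw [← closure_interior_Icc_pi hab] at hx
  refine le_on_closure (s := interior (Set.Icc a (fun i => a i + h)))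
    (f := fun x => |f x - MvPolynomial.eval x (taylorPoly ⌈β - 1⌉₊ f c)|)
    (g := fun _ => m ^ ⌈β - 1⌉₊ * (r * (m : ℝ) ^ (β - (⌈β - 1⌉₊ : ℝ))) * h ^ β) ?_ ?_
    continuousOn_const hx
  · intro z hz
    refine (abs_sub_taylorPoly_le hβ hr hf (interior_mono hsub hcI)
      (interior_mono hsub hz)).trans ?_
    have hzc : ‖z - c‖ ≤ h := by
      rw [pi_norm_le_iff_of_nonneg hh.le]
      intro i
      have hz' := interior_subset hz
      have h1 := hz'.1 i
      have h2 := hz'.2 i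
      simp only [Pi.sub_apply, hc, Real.norm_eq_abs, abs_le]
      constructor <;> linarith
    calc _ ≤ m ^ ⌈β - 1⌉₊ * h ^ ⌈β - 1⌉₊ * (r * (m * h) ^ (β - (⌈β - 1⌉₊ : ℝ))) := by gcongr
      _ = _ := by
        rw [Real.mul_rpow (by positivity) hh.le]
        have : h ^ β = h ^ ⌈β - 1⌉₊ * h ^ (β - (⌈β - 1⌉₊ : ℝ)) := by
          rw [← Real.rpow_natCast, ← Real.rpow_add hh, add_sub_cancel]
        rw [this]; ring
  · rw [closure_interior_Icc_pi hab]
    exact ((hf.1.1.mono hsub).sub (MvPolynomial.continuous_eval _).continuousOn).abs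

/-! ### Partitions into classes of small uniform diameter -/

/-- The set `G` of functions can be partitioned into at most `N` subsets, each of which has diameter
at most `ε` in the uniform norm on `S`. -/
def HasFinePartition {X : Type} (G : Set (X → ℝ)) (S : Set X) (ε N : ℝ) : Prop :=
  ∃ (ι : Type) (_ : Fintype ι) (φ : (X → ℝ) → ι), (Fintype.card ι : ℝ) ≤ N ∧
    ∀ f ∈ G, ∀ g ∈ G, φ f = φ g → ∀ x ∈ S, |f x - g x| ≤ ε

/-- Closed dyadic subcubes of the unit cube. -/
def dyadicCube (l : ℕ) (k : Fin m → Fin (2 ^ l)) : Set (Fin m → ℝ) :=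
  Set.Icc (fun i => (k i : ℝ) * (1 / 2) ^ l) (fun i => (k i : ℝ) * (1 / 2) ^ l + (1 / 2) ^ l)

theorem exists_mem_dyadicCube (l : ℕ) {x : Fin m → ℝ} (hx : x ∈ Set.Icc (0 : Fin m → ℝ) 1) :
    ∃ k : Fin m → Fin (2 ^ l), x ∈ dyadicCube l k := by
  have key : ∀ i, ∃ k : Fin (2 ^ l), (k : ℝ) * (1 / 2) ^ l ≤ x i ∧
      x i ≤ (k : ℝ) * (1 / 2) ^ l + (1 / 2) ^ l := by
    intro i
    have h0 : 0 ≤ x i := hx.1 i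
    have h1 : x i ≤ 1 := hx.2 i
    have hp : (2 : ℝ) ^ l * (1 / 2) ^ l = 1 := by rw [← mul_pow]; norm_num
    have hpos : (0 : ℝ) < (1 / 2) ^ l := by positivity
    have hpos' : (1 : ℕ) ≤ 2 ^ l := Nat.one_le_two_pow
    have hxi : x i = (2 ^ l * x i) * (1 / 2) ^ l := by
      rw [mul_right_comm, hp, one_mul]
    by_cases hlt : ⌊2 ^ l * x i⌋₊ < 2 ^ l
    · refine ⟨⟨_, hlt⟩, ?_, ?_⟩
      · conv_rhs => rw [hxi]
        gcongr
        exact Nat.floor_le (by positivity)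
      · rw [← add_one_mul]
        conv_lhs => rw [hxi]
        gcongr
        exact (Nat.lt_floor_add_one _).le
    · have h2 : (2 : ℝ) ^ l ≤ 2 ^ l * x i := by
        have := (Nat.le_floor_iff (by positivity)).1 (not_lt.1 hlt)
        exact_mod_cast this
      have hx1 : x i = 1 := le_antisymm h1 (le_of_mul_le_mul_left (by simpa using h2)
        (by positivity : (0 : ℝ) < 2 ^ l))
      refine ⟨⟨2 ^ l - 1, by omega⟩, ?_, ?_⟩ <;>
      · simp only [Nat.cast_sub hpos']
        push_cast
        rw [sub_mul, hp, hx1]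
        linarith
  choose k hk using key
  exact ⟨k, fun i => (hk i).1, fun i => (hk i).2⟩

theorem dyadicCube_subset (l : ℕ) (k : Fin m → Fin (2 ^ l)) :
    (∀ i, 0 ≤ (k i : ℝ) * (1 / 2) ^ l) ∧ ∀ i, (k i : ℝ) * (1 / 2) ^ l + (1 / 2) ^ l ≤ 1 := by
  refine ⟨fun i => by positivity, fun i => ?_⟩
  have hp : (2 : ℝ) ^ l * (1 / 2) ^ l = 1 := by rw [← mul_pow]; norm_num
  have hk : (k i : ℝ) + 1 ≤ 2 ^ l := by exact_mod_cast (k i).2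
  calc _ = ((k i : ℝ) + 1) * (1 / 2) ^ l := by ring
    _ ≤ 2 ^ l * (1 / 2) ^ l := by gcongr
    _ = 1 := hp

/-- Polynomials of bounded degree that are uniformly bounded on a compact set can be partitioned
into a number of classes of uniform diameter at most one that does not depend on the set. -/
theorem exists_polynomial_quantizer (m p : ℕ) (A : ℝ) : ∃ M : ℕ, ∀ Q : Set (Fin m → ℝ),
    IsCompact Q → ∃ φ : MvPolynomial (Fin m) ℝ → Fin M,
      ∀ u ∈ MvPolynomial.restrictTotalDegree (Fin m) ℝ p,
      ∀ v ∈ MvPolynomial.restrictTotalDegree (Fin m) ℝ p,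
      (∀ x ∈ Q, |MvPolynomial.eval x u| ≤ A) → (∀ x ∈ Q, |MvPolynomial.eval x v| ≤ A) →
      φ u = φ v → ∀ x ∈ Q, |MvPolynomial.eval x u - MvPolynomial.eval x v| ≤ 1 := by
  classical
  obtain ⟨M, hM⟩ := exists_quantizer
    (Module.finrank ℝ (MvPolynomial.restrictTotalDegree (Fin m) ℝ p)) (max A 0)
  refine ⟨M, fun Q hQ => ?_⟩
  have : CompactSpace Q := isCompact_iff_compactSpace.1 hQ
  -- Restriction to `Q` may lose dimensions but never adds any, so a single `M` serves all compact
  -- sets, under their own uniform norms.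
  let L : MvPolynomial (Fin m) ℝ →ₐ[ℝ] C(Q, ℝ) :=
    MvPolynomial.aeval fun i => ⟨fun x : Q => x.1 i, (continuous_apply i).comp continuous_subtype_val⟩
  have hL : ∀ u (x : Q), L u x = MvPolynomial.eval x.1 u := by
    intro u x
    induction u using MvPolynomial.induction_on with
    | C a => simp [L]
    | add p q hp hq => simp [hp, hq]
    | mul_X p i hp => simp [hp, L]
  let V := (MvPolynomial.restrictTotalDegree (Fin m) ℝ p).map L.toLinearMap
  obtain ⟨φ, hφ⟩ := hM V (Submodule.finrank_map_le _ _)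
  have hmem : ∀ u ∈ MvPolynomial.restrictTotalDegree (Fin m) ℝ p, L u ∈ V :=
    fun u hu => Submodule.mem_map_of_mem (f := L.toLinearMap) hu
  refine ⟨fun u => φ (if hu : L u ∈ V then ⟨L u, hu⟩ else 0), fun u hu v hv hub hvb h x hx => ?_⟩
  simp only [dif_pos (hmem u hu), dif_pos (hmem v hv)] at h
  have hn : ∀ w (hw : L w ∈ V), (∀ x ∈ Q, |MvPolynomial.eval x w| ≤ A) →
      ‖(⟨L w, hw⟩ : V)‖ ≤ max A 0 := by
    intro w hw hwb
    change ‖L w‖ ≤ _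
    rw [ContinuousMap.norm_le _ (le_max_right _ _)]
    intro x
    rw [hL]
    exact (hwb x.1 x.2).trans (le_max_left _ _)
  have h := hφ _ _ (hn u _ hub) (hn v _ hvb) h
  change ‖L u - L v‖ ≤ 1 at h
  have h := (ContinuousMap.norm_le _ zero_le_one).1 h ⟨x, hx⟩
  rwa [ContinuousMap.sub_apply, hL, hL] at h

theorem HasFinePartition.mono {X : Type} {G G' : Set (X → ℝ)} {S S' : Set X} {ε ε' N N' : ℝ}
    (h : HasFinePartition G S ε N) (hG : G' ⊆ G) (hS : S' ⊆ S) (hε : ε ≤ ε') (hN : N ≤ N') :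
    HasFinePartition G' S' ε' N' := by
  obtain ⟨ι, hι, φ, h1, h2⟩ := h
  exact ⟨ι, hι, φ, h1.trans hN, fun f hf g hg hfg x hx =>
    (h2 f (hG hf) g (hG hg) hfg x (hS hx)).trans hε⟩

theorem abs_le_of_mem_holderBall (hβ : 0 < β) (hr : 0 ≤ r)
    (hf : f ∈ holderBall β r (Set.Icc 0 1)) {x : Fin m → ℝ} (hx : x ∈ Set.Icc 0 1) :
    |f x| ≤ r := by
  have hc := closure_interior_Icc_pi (m := m) (a := 0) (b := 1) (by simp)
  rw [← hc] at hx
  refine le_on_closure (s := interior (Set.Icc (0 : Fin m → ℝ) 1)) (f := fun x => |f x|)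
    (g := fun _ => r) (fun z hz => ?_) ?_ continuousOn_const hx
  · simpa [pderiv] using abs_pderiv_le hr hf (k := 0) (by simpa using hβ) Fin.elim0 hz
  · rw [hc]; exact hf.1.1.abs

/-- Refinement of a partition of a Hölder ball from one dyadic scale to the next one. -/
theorem exists_dyadic_partition (hm : 1 ≤ m) (hβ : 0 < β) (hr : 0 < r) :
    ∃ (C : ℝ) (M : ℕ), 1 ≤ C ∧ 1 ≤ M ∧ ∀ l : ℕ,
      HasFinePartition (holderBall β r (Set.Icc (0 : Fin m → ℝ) 1)) (Set.Icc 0 1)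
        (C * ((1 / 2) ^ l : ℝ) ^ β) ((M : ℝ) ^ (2 * 2 ^ (l * m))) := by
  classical
  set p := ⌈β - 1⌉₊ with hp
  set CT : ℝ := m ^ p * (r * (m : ℝ) ^ (β - (p : ℝ))) with hCT
  have hCT0 : 0 ≤ CT := by positivity
  -- Two Taylor errors and one quantization error make up `2 * CT + 1`; the summand `2 * r` covers
  -- scale zero, where there is a single class.
  set C : ℝ := 2 * CT + 1 + 2 * r with hC
  -- In units of `h ^ β`, members of one coarse class differ by at most `C * 2 ^ β`, since the
  -- coarse mesh is `2h`; passing to their Taylor polynomials adds `2 * CT`.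
  obtain ⟨M, hM⟩ := exists_polynomial_quantizer m p (C * 2 ^ β + 2 * CT)
  have hM1 : 1 ≤ M := by
    obtain ⟨φ, -⟩ := hM ∅ isCompact_empty
    exact (Nat.zero_le _).trans_lt (φ 0).2
  refine ⟨C, M, by linarith, hM1, fun l => ?_⟩
  induction l with
  | zero =>
    refine ⟨Unit, inferInstance, fun _ => (), ?_, fun f hf g hg _ x hx => ?_⟩
    · simpa using hM1
    · have h1 := abs_le_of_mem_holderBall hβ hr.le hf hx
      have h2 := abs_le_of_mem_holderBall hβ hr.le hg hx
      have h3 := abs_sub (f x) (g x)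
      simp only [pow_zero, Real.one_rpow, mul_one]
      linarith
  | succ l ih =>
    obtain ⟨ι, hι, φ, hcard, hφ⟩ := ih
    set h : ℝ := (1 / 2) ^ (l + 1) with hh
    have hh0 : 0 < h := by positivity
    have hhβ : 0 < h ^ β := by positivity
    have hscale : ((1 / 2) ^ l : ℝ) ^ β = 2 ^ β * h ^ β := by
      rw [← Real.mul_rpow (by norm_num) hh0.le, hh, pow_succ]
      congr 1; ring
    have hT : ∀ (f : (Fin m → ℝ) → ℝ) (k : Fin m → Fin (2 ^ (l + 1))),
        ∃ T ∈ MvPolynomial.restrictTotalDegree (Fin m) ℝ p,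
          f ∈ holderBall β r (Set.Icc 0 1) → ∀ x ∈ dyadicCube (l + 1) k,
            |f x - MvPolynomial.eval x T| ≤ CT * h ^ β := by
      intro f k
      by_cases hf : f ∈ holderBall β r (Set.Icc 0 1)
      · obtain ⟨h1, h2⟩ := dyadicCube_subset (l + 1) k
        obtain ⟨T, hT, hT'⟩ := exists_polynomial_approx hβ hr.le hf hh0 h1 h2
        exact ⟨T, hT, fun _ => hT'⟩
      · exact ⟨0, Submodule.zero_mem _, fun h => absurd h hf⟩
    choose T hTdeg hTapprox using hT
    have hq := fun k => hM (dyadicCube (m := m) (l + 1) k) isCompact_Icc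
    choose ψ hψ using hq
    -- Only the deviation from a fixed representative of the coarse class is quantized. Quantizing
    -- the polynomials themselves would need more labels per cube as the mesh shrinks.
    have hrep : ∀ a : ι, ∃ f₀, (∃ f ∈ holderBall β r (Set.Icc (0 : Fin m → ℝ) 1), φ f = a) →
        f₀ ∈ holderBall β r (Set.Icc (0 : Fin m → ℝ) 1) ∧ φ f₀ = a := by
      intro a
      by_cases ha : ∃ f ∈ holderBall β r (Set.Icc (0 : Fin m → ℝ) 1), φ f = a
      · obtain ⟨f, hf⟩ := ha
        exact ⟨f, fun _ => hf⟩
      · exact ⟨0, fun h => absurd h ha⟩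
    choose rep hrep using hrep
    let u := fun (f : (Fin m → ℝ) → ℝ) (k : Fin m → Fin (2 ^ (l + 1))) =>
      MvPolynomial.C (h ^ β)⁻¹ * (T f k - T (rep (φ f)) k)
    have hudeg : ∀ f k, u f k ∈ MvPolynomial.restrictTotalDegree (Fin m) ℝ p := fun f k => by
      simp only [u, ← MvPolynomial.smul_eq_C_mul]
      exact Submodule.smul_mem _ _ (Submodule.sub_mem _ (hTdeg _ _) (hTdeg _ _))
    have hubound : ∀ f ∈ holderBall β r (Set.Icc (0 : Fin m → ℝ) 1), ∀ k,
        ∀ x ∈ dyadicCube (l + 1) k, |MvPolynomial.eval x (u f k)| ≤ C * 2 ^ β + 2 * CT := by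
      intro f hf k x hx
      obtain ⟨hr1, hr2⟩ := hrep (φ f) ⟨f, hf, rfl⟩
      have hx1 : x ∈ Set.Icc (0 : Fin m → ℝ) 1 := by
        obtain ⟨h1, h2⟩ := dyadicCube_subset (l + 1) k
        exact Set.Icc_subset_Icc h1 h2 hx
      have b1 := hTapprox f k hf x hx
      have b2 := hTapprox _ k hr1 x hx
      have b3 := hφ f hf _ hr1 hr2.symm x hx1
      rw [hscale] at b3
      simp only [u, map_mul, map_sub, MvPolynomial.eval_C, abs_mul]
      rw [abs_of_pos (inv_pos.2 hhβ), inv_mul_le_iff₀ hhβ]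
      rw [abs_le] at b1 b2 b3 ⊢
      constructor <;> nlinarith [b1.1, b1.2, b2.1, b2.2, b3.1, b3.2]
    refine ⟨ι × ((Fin m → Fin (2 ^ (l + 1))) → Fin M), inferInstance,
      fun f => (φ f, fun k => ψ k (u f k)), ?_, fun f hf g hg hfg x hx => ?_⟩
    · rw [Fintype.card_prod, Fintype.card_fun, Fintype.card_fun]
      simp only [Fintype.card_fin]
      push_cast
      rw [← pow_mul]
      have hM1' : (1 : ℝ) ≤ M := by exact_mod_cast hM1
      calc (Fintype.card ι : ℝ) * (M : ℝ) ^ 2 ^ ((l + 1) * m)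
          ≤ (M : ℝ) ^ (2 * 2 ^ (l * m)) * (M : ℝ) ^ 2 ^ ((l + 1) * m) := by gcongr
        _ = (M : ℝ) ^ (2 * 2 ^ (l * m) + 2 ^ ((l + 1) * m)) := by rw [pow_add]
        _ ≤ _ := by
          refine pow_le_pow_right₀ hM1' ?_
          -- As `m ≥ 1`, the number of cubes at least doubles with each scale, so the label counts
          -- sum to at most twice the last one.
          have : 2 * 2 ^ (l * m) ≤ 2 ^ ((l + 1) * m) := by
            rw [← pow_succ']
            exact Nat.pow_le_pow_right two_pos (by nlinarith)
          omega
    · simp only [Prod.mk.injEq] at hfg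
      obtain ⟨h1, h2⟩ := hfg
      obtain ⟨k, hk⟩ := exists_mem_dyadicCube (l + 1) hx
      have b := hψ k _ (hudeg f k) _ (hudeg g k) (hubound f hf k) (hubound g hg k)
        (congrFun h2 k) x hk
      have b1 := hTapprox f k hf x hk
      have b2 := hTapprox g k hg x hk
      -- Equal coarse labels mean the same representative, whose polynomial cancels in the
      -- difference.
      simp only [u, h1, map_mul, map_sub, MvPolynomial.eval_C] at b
      rw [← mul_sub, sub_sub_sub_cancel_right, abs_mul, abs_of_pos (inv_pos.2 hhβ),
        inv_mul_le_iff₀ hhβ] at b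
      have b4 : 0 ≤ 2 * r * h ^ β := by positivity
      rw [hC]
      rw [abs_le] at b b1 b2 ⊢
      constructor <;> nlinarith [b1.1, b1.2, b2.1, b2.2, b.1, b.2]

/-- The metric entropy of a Hölder ball (Kolmogorov and Tikhomirov). -/
theorem exists_holderBall_partition (hm : 1 ≤ m) (hβ : 0 < β) (hr : 0 < r) :
    ∃ C : ℝ, 0 < C ∧ ∀ ε : ℝ, 0 < ε → ε ≤ 1 →
      HasFinePartition (holderBall β r (Set.Icc (0 : Fin m → ℝ) 1)) (Set.Icc 0 1) ε
        (Real.exp (C * ε ^ (-(m / β)))) := by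
  obtain ⟨C, M, hC, hM, h⟩ := exists_dyadic_partition hm hβ hr
  have hC0 : 0 < C := by linarith
  have hM1 : (1 : ℝ) ≤ M := by exact_mod_cast hM
  -- Adding one keeps the constant positive when `M = 1`.
  refine ⟨(Real.log M + 1) * (2 * (2 ^ m * C ^ (m / β))), ?_, fun ε hε hε1 => ?_⟩
  · have := Real.log_nonneg hM1
    positivity
  set X := (C / ε) ^ (1 / β) with hX
  have hCε : 1 ≤ C / ε := (one_le_div hε).2 (by linarith)
  have hX1 : 1 ≤ X := Real.one_le_rpow hCε (by positivity)
  -- At mesh `X⁻¹` the diameter would be exactly `ε`; the dyadic mesh just below it costs a factor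
  -- at most `2 ^ m` in the number of cubes.
  obtain ⟨n, hn1, hn2⟩ := exists_nat_pow_near hX1 (one_lt_two)
  refine (h (n + 1)).mono le_rfl le_rfl ?_ ?_
  · have h1 : ((1 / 2 : ℝ) ^ (n + 1)) ≤ X⁻¹ := by
      rw [one_div, inv_pow]
      exact inv_anti₀ (by positivity) hn2.le
    calc C * ((1 / 2 : ℝ) ^ (n + 1)) ^ β ≤ C * (X⁻¹) ^ β := by gcongr
      _ = ε := by
        rw [hX, Real.inv_rpow (by positivity), ← Real.rpow_mul (by positivity),
          one_div_mul_cancel hβ.ne', Real.rpow_one]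
        field_simp
  · have h2 : ((2 : ℝ) ^ ((n + 1) * m)) ≤ 2 ^ m * C ^ (m / β) * ε ^ (-(m / β)) := by
      calc (2 : ℝ) ^ ((n + 1) * m) = 2 ^ m * (2 ^ n) ^ m := by
            rw [← pow_mul, ← pow_add]; congr 1; ring
        _ ≤ 2 ^ m * X ^ m := by gcongr
        _ = _ := by
          rw [hX, ← Real.rpow_natCast (_ ^ (1 / β)), ← Real.rpow_mul (by positivity),
            Real.div_rpow hC0.le hε.le, Real.rpow_neg hε.le, one_div_mul_eq_div]
          ring
    rw [← Real.rpow_natCast, Real.rpow_def_of_pos (by linarith)]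
    refine Real.exp_le_exp.2 ?_
    push_cast
    have hlog := Real.log_nonneg hM1
    calc Real.log M * (2 * 2 ^ ((n + 1) * m))
        ≤ (Real.log M + 1) * (2 * (2 ^ m * C ^ (m / β) * ε ^ (-(m / β)))) := by
          gcongr
          linarith
      _ = _ := by ring

end HolderBall

section Composition

variable {m d q K dM ds : ℕ} {β r : ℝ}

/-! ### Hölder continuity of compositional functions -/

/-- For `β ≤ 1` this is the Hölder seminorm itself; for `β > 1` the first partial derivatives are
bounded by `r` and the mean value inequality applies. -/
theorem abs_sub_le_of_mem_holderBall_interior (hβ : 0 < β) (hr : 0 ≤ r)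
    {f : (Fin m → ℝ) → ℝ} (hf : f ∈ holderBall β r (Set.Icc 0 1)) {x z : Fin m → ℝ}
    (hx : x ∈ interior (Set.Icc (0 : Fin m → ℝ) 1))
    (hz : z ∈ interior (Set.Icc (0 : Fin m → ℝ) 1)) :
    |f x - f z| ≤ r * (m * ‖x - z‖) ^ min 1 β := by
  rcases le_or_gt β 1 with h | h
  · have hp : ⌈β - 1⌉₊ = 0 := Nat.ceil_eq_zero.2 (by linarith)
    have h1 := abs_iteratedFDeriv_sub_le hβ hr hf 0 hx hz
    rw [hp] at h1
    simpa [h] using h1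
  · rw [min_eq_left h.le, Real.rpow_one]
    have hp : 1 ≤ ⌈β - 1⌉₊ := Nat.one_le_ceil_iff.2 (by linarith)
    have hfd : ∀ y ∈ interior (Set.Icc (0 : Fin m → ℝ) 1), ‖fderiv ℝ f y‖ ≤ r * m := by
      intro y hy
      refine ContinuousLinearMap.opNorm_le_bound _ (by positivity) fun v => ?_
      have h1 : fderiv ℝ f y v = iteratedFDeriv ℝ 1 f y fun _ => v := by
        rw [iteratedFDeriv_one_apply]
      rw [h1, iteratedFDeriv_apply_eq_sum, Real.norm_eq_abs]
      refine (Finset.abs_sum_le_sum_abs _ _).trans ?_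
      calc _ ≤ ∑ _i : Fin 1 → Fin m, r * ‖v‖ := by
            refine Finset.sum_le_sum fun i _ => ?_
            rw [abs_mul]
            gcongr
            · exact abs_pderiv_le hr hf (by simpa using h) i hy
            · simpa using norm_le_pi_norm v (i 0)
        _ = r * m * ‖v‖ := by simp; ring
    have hdiff : ∀ y ∈ interior (Set.Icc (0 : Fin m → ℝ) 1), DifferentiableAt ℝ f y :=
      fun y hy => (hf.1.2.1.differentiableOn (by exact_mod_cast (by omega))).differentiableAt
        (isOpen_interior.mem_nhds hy)
    have := Convex.norm_image_sub_le_of_norm_fderiv_le hdiff hfd (convex_Icc _ _).interior hz hx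
    rw [Real.norm_eq_abs] at this
    linarith

theorem abs_sub_le_of_mem_holderBall (hβ : 0 < β) (hr : 0 ≤ r)
    {f : (Fin m → ℝ) → ℝ} (hf : f ∈ holderBall β r (Set.Icc 0 1)) {x z : Fin m → ℝ}
    (hx : x ∈ Set.Icc 0 1) (hz : z ∈ Set.Icc 0 1) :
    |f x - f z| ≤ r * (m * ‖x - z‖) ^ min 1 β := by
  have hc : closure (interior (Set.Icc (0 : Fin m → ℝ) 1) ×ˢ
      interior (Set.Icc (0 : Fin m → ℝ) 1)) = Set.Icc 0 1 ×ˢ Set.Icc 0 1 := by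
    rw [closure_prod_eq, closure_interior_Icc_pi (by simp)]
  have hxz : (x, z) ∈ closure (interior (Set.Icc (0 : Fin m → ℝ) 1) ×ˢ
      interior (Set.Icc (0 : Fin m → ℝ) 1)) := hc ▸ ⟨hx, hz⟩
  refine le_on_closure (f := fun w : (Fin m → ℝ) × (Fin m → ℝ) => |f w.1 - f w.2|)
    (g := fun w => r * (m * ‖w.1 - w.2‖) ^ min 1 β)
    (fun w hw => abs_sub_le_of_mem_holderBall_interior hβ hr hf hw.1 hw.2) ?_ ?_ hxz
  · rw [hc]
    exact ((hf.1.1.comp continuousOn_fst fun w hw => hw.1).sub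
      (hf.1.1.comp continuousOn_snd fun w hw => hw.2)).abs
  · refine (Continuous.mul continuous_const ?_).continuousOn
    exact Continuous.rpow_const (by fun_prop) fun _ => Or.inr (by positivity)

theorem norm_sub_le_one (x z : Cube d) : ‖x.1 - z.1‖ ≤ 1 := by
  rw [pi_norm_le_iff_of_nonneg zero_le_one]
  intro i
  have h1 := x.2.1 i
  have h2 := x.2.2 i
  have h3 := z.2.1 i
  have h4 := z.2.2 i
  simp only [Pi.zero_apply, Pi.one_apply] at h1 h2 h3 h4
  rw [Pi.sub_apply, Real.norm_eq_abs, abs_le]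
  constructor <;> linarith

theorem restrict_mem_Icc (x : Cube d) {k : ℕ} (e : Fin k → Fin d) :
    (fun j => x.1 (e j)) ∈ Set.Icc (0 : Fin k → ℝ) 1 :=
  ⟨fun j => x.2.1 (e j), fun j => x.2.2 (e j)⟩

/-- Maxima are 1-Lipschitz in the sup norm, hence Hölder of exponent `min 1 β`, because the cube has
diameter at most one. -/
theorem exists_holder_const (hβ : 0 < β) (hr : 0 < r) : ∃ C : ℝ, 1 ≤ C ∧
    ∀ d, ∀ f ∈ classH d ds β r ∪ classM d dM, ∀ x z : Cube d,
      |f x - f z| ≤ C * ‖x.1 - z.1‖ ^ min 1 β := by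
  have hγ : 0 < min 1 β := lt_min one_pos hβ
  refine ⟨max 1 (r * (ds : ℝ) ^ min 1 β), le_max_left _ _, fun d f hf x z => ?_⟩
  rcases hf with ⟨I, hI, g, hg, hfg⟩ | ⟨I, hI, -, hfI⟩
  · rw [hfg, hfg]
    refine (abs_sub_le_of_mem_holderBall hβ hr.le hg (restrict_mem_Icc x _)
      (restrict_mem_Icc z _)).trans ?_
    rw [Real.mul_rpow (by positivity) (by positivity), ← mul_assoc]
    gcongr
    · exact le_max_right _ _
    · rw [pi_norm_le_iff_of_nonneg (norm_nonneg _)]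
      exact fun j => norm_le_pi_norm (x.1 - z.1) _
  · rw [hfI, hfI]
    have key : ∀ x z : Cube d, I.sup' hI (fun i => x.1 i) - I.sup' hI (fun i => z.1 i) ≤
        ‖x.1 - z.1‖ := by
      intro x z
      rw [sub_le_iff_le_add', Finset.sup'_le_iff]
      intro i hi
      have h1 := Finset.le_sup' (fun i => z.1 i) hi
      have h2 := (le_abs_self _).trans (norm_le_pi_norm (x.1 - z.1) i)
      simp only [Pi.sub_apply] at h1 h2
      linarith
    have h1 : |I.sup' hI (fun i => x.1 i) - I.sup' hI (fun i => z.1 i)| ≤ ‖x.1 - z.1‖ := by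
      rw [abs_le]
      have := key z x
      rw [norm_sub_rev] at this
      exact ⟨by linarith, key x z⟩
    calc _ ≤ ‖x.1 - z.1‖ := h1
      _ ≤ ‖x.1 - z.1‖ ^ min 1 β := by
        have := Real.rpow_le_rpow_of_exponent_ge' (norm_nonneg _) (norm_sub_le_one x z)
          hγ.le (min_le_left 1 β)
        rwa [Real.rpow_one] at this
      _ ≤ _ := le_mul_of_one_le_left (by positivity) (le_max_left _ _)

/-- Hölder exponents multiply under composition, one factor `min 1 β` for each of the `q + 1`
layers. -/
theorem exists_holder_const_classCHOM (hβ : 0 < β) (hr : 0 < r) (q d : ℕ) : ∃ C : ℝ, 1 ≤ C ∧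
    ∀ f ∈ classCHOM K dM ds β r q d, ∀ x z : Cube d,
      |f x - f z| ≤ C * ‖x.1 - z.1‖ ^ (min 1 β ^ (q + 1)) := by
  have hγ : 0 < min 1 β := lt_min one_pos hβ
  obtain ⟨C₀, hC₀, h₀⟩ := exists_holder_const (dM := dM) (ds := ds) hβ hr
  induction q generalizing d with
  | zero => exact ⟨C₀, hC₀, by simpa only [zero_add, pow_one, classCHOM] using h₀ d⟩
  | succ q ih =>
    obtain ⟨C₁, hC₁, h₁⟩ := ih K
    refine ⟨C₁ * C₀ ^ (min 1 β ^ (q + 1)), ?_, ?_⟩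
    · exact one_le_mul_of_one_le_of_one_le hC₁ (Real.one_le_rpow hC₀ (by positivity))
    · rintro f ⟨h, hh, g, hg, rfl⟩ x z
      refine (h₁ g hg (h x) (h z)).trans ?_
      have hxz : ‖(h x).1 - (h z).1‖ ≤ C₀ * ‖x.1 - z.1‖ ^ min 1 β := by
        rw [pi_norm_le_iff_of_nonneg (by positivity)]
        exact fun j => h₀ d _ (hh j) x z
      calc C₁ * ‖(h x).1 - (h z).1‖ ^ (min 1 β ^ (q + 1))
          ≤ C₁ * (C₀ * ‖x.1 - z.1‖ ^ min 1 β) ^ (min 1 β ^ (q + 1)) := by gcongr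
        _ = _ := by
          rw [Real.mul_rpow (by positivity) (by positivity),
            ← Real.rpow_mul (norm_nonneg _), ← pow_succ', mul_assoc]

theorem continuous_of_mem_classCHOM (hβ : 0 < β) (hr : 0 < r) {f : Cube d → ℝ}
    (hf : f ∈ classCHOM K dM ds β r q d) : Continuous f := by
  obtain ⟨C, hC, h⟩ := exists_holder_const_classCHOM (K := K) (dM := dM) (ds := ds) hβ hr q d
  have hγ : 0 < min 1 β := lt_min one_pos hβ
  rw [continuous_iff_continuousAt]
  intro x
  rw [ContinuousAt, tendsto_iff_dist_tendsto_zero]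
  have hlim : Filter.Tendsto (fun z : Cube d => C * ‖z.1 - x.1‖ ^ (min 1 β ^ (q + 1)))
      (nhds x) (nhds 0) := by
    have hcont : Continuous fun z : Cube d => C * ‖z.1 - x.1‖ ^ (min 1 β ^ (q + 1)) := by
      refine Continuous.mul continuous_const ?_
      exact Continuous.rpow_const (by fun_prop) fun _ => Or.inr (by positivity)
    have := hcont.tendsto x
    simpa [Real.zero_rpow (pow_pos hγ (q + 1)).ne'] using this
  exact squeeze_zero (fun _ => dist_nonneg) (fun z => h f hf z x) hlim

/-! ### Metric entropy of compositional functions -/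

theorem HasFinePartition.union {X : Type} {G₁ G₂ : Set (X → ℝ)} {S : Set X} {ε N₁ N₂ : ℝ}
    (h₁ : HasFinePartition G₁ S ε N₁) (h₂ : HasFinePartition G₂ S ε N₂) :
    HasFinePartition (G₁ ∪ G₂) S ε (N₁ + N₂) := by
  classical
  obtain ⟨ι₁, _, φ₁, hc₁, hφ₁⟩ := h₁
  obtain ⟨ι₂, _, φ₂, hc₂, hφ₂⟩ := h₂
  refine ⟨ι₁ ⊕ ι₂, inferInstance, fun f => if f ∈ G₁ then .inl (φ₁ f) else .inr (φ₂ f), ?_, ?_⟩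
  · rw [Fintype.card_sum]
    push_cast
    linarith
  · intro f hf g hg hfg
    by_cases hf1 : f ∈ G₁ <;> by_cases hg1 : g ∈ G₁ <;>
      simp only [hf1, hg1, if_true, if_false, Sum.inl.injEq, Sum.inr.injEq, reduceCtorEq] at hfg
    · exact hφ₁ f hf1 g hg1 hfg
    · exact hφ₂ f (hf.resolve_left hf1) g (hg.resolve_left hg1) hfg

theorem classM_hasFinePartition {ε : ℝ} (hε : 0 ≤ ε) :
    HasFinePartition (classM d dM) Set.univ ε (2 ^ d) := by
  have hex : ∀ f : Cube d → ℝ, ∃ I : Finset (Fin d), f ∈ classM d dM →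
      ∃ hI : I.Nonempty, ∀ x : Cube d, f x = I.sup' hI (fun i => x.1 i) := by
    intro f
    by_cases hf : f ∈ classM d dM
    · obtain ⟨I, hI, -, h⟩ := hf
      exact ⟨I, fun _ => ⟨hI, h⟩⟩
    · exact ⟨∅, fun h => absurd h hf⟩
  choose φ hφ using hex
  refine ⟨Finset (Fin d), inferInstance, φ, by simp, fun f hf g hg hfg x _ => ?_⟩
  obtain ⟨h1, h1'⟩ := hφ f hf
  obtain ⟨h2, h2'⟩ := hφ g hg
  rw [h1' x, h2' x]
  simpa [hfg] using hε

theorem classH_hasFinePartition {ε N : ℝ}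
    (h : HasFinePartition (holderBall β r (Set.Icc (0 : Fin ds → ℝ) 1)) (Set.Icc 0 1) ε N) :
    HasFinePartition (classH d ds β r) Set.univ ε (2 ^ d * N) := by
  obtain ⟨ι, _, ψ, hc, hψ⟩ := h
  have hex : ∀ f : Cube d → ℝ, ∃ (I : Finset (Fin d)) (g : (Fin ds → ℝ) → ℝ),
      f ∈ classH d ds β r → ∃ hI : I.card = ds, g ∈ holderBall β r (Set.Icc 0 1) ∧
        ∀ x : Cube d, f x = g (fun j => x.1 (I.orderEmbOfFin hI j)) := by
    intro f
    by_cases hf : f ∈ classH d ds β r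
    · obtain ⟨I, hI, g, hg, h⟩ := hf
      exact ⟨I, g, fun _ => ⟨hI, hg, h⟩⟩
    · exact ⟨∅, 0, fun h => absurd h hf⟩
  choose I G hIG using hex
  refine ⟨Finset (Fin d) × ι, inferInstance, fun f => (I f, ψ (G f)), ?_,
    fun f hf g hg hfg x _ => ?_⟩
  · rw [Fintype.card_prod]
    push_cast
    simp only [Fintype.card_finset, Fintype.card_fin]
    push_cast
    gcongr
  · obtain ⟨h1, h1', h1''⟩ := hIG f hf
    obtain ⟨h2, h2', h2''⟩ := hIG g hg
    simp only [Prod.mk.injEq] at hfg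
    have hsame : (fun j => x.1 ((I f).orderEmbOfFin h1 j)) =
        fun j => x.1 ((I g).orderEmbOfFin h2 j) := by simp only [hfg.1]
    rw [h1'' x, h2'' x, ← hsame]
    exact hψ _ h1' _ h2' hfg.2 _ (restrict_mem_Icc x _)

theorem exists_component_partition (hds : 1 ≤ ds) (hβ : 0 < β) (hr : 0 < r) (d : ℕ) :
    ∃ C : ℝ, 0 < C ∧ ∀ ε : ℝ, 0 < ε → ε ≤ 1 →
      HasFinePartition (classH d ds β r ∪ classM d dM) Set.univ ε
        (Real.exp (C * ε ^ (-(ds / β)))) := by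
  obtain ⟨C, hC, h⟩ := exists_holderBall_partition hds hβ hr
  refine ⟨C + (d + 1), by positivity, fun ε hε hε1 => ?_⟩
  have hpow : 1 ≤ ε ^ (-(ds / β)) :=
    Real.one_le_rpow_of_pos_of_le_one_of_nonpos hε hε1 (by simp only [neg_nonpos]; positivity)
  refine ((classH_hasFinePartition (d := d) (h ε hε hε1)).union
    (classM_hasFinePartition hε.le)).mono le_rfl le_rfl le_rfl ?_
  have h2 : (2 : ℝ) ^ (d + 1) ≤ Real.exp ((d + 1) * ε ^ (-(ds / β))) := by
    calc (2 : ℝ) ^ (d + 1) ≤ Real.exp 1 ^ (d + 1) := by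
          gcongr
          linarith [Real.add_one_le_exp (1 : ℝ)]
      _ = Real.exp (d + 1) := by rw [← Real.exp_nat_mul]; simp
      _ ≤ _ := Real.exp_le_exp.2 (le_mul_of_one_le_right (by positivity) hpow)
  have h3 : 1 ≤ Real.exp (C * ε ^ (-(ds / β))) := Real.one_le_exp (by positivity)
  calc (2 : ℝ) ^ d * Real.exp (C * ε ^ (-(ds / β))) + 2 ^ d
      ≤ 2 ^ (d + 1) * Real.exp (C * ε ^ (-(ds / β))) := by
        rw [pow_succ]
        nlinarith [show (0 : ℝ) < 2 ^ d by positivity]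
    _ ≤ Real.exp ((d + 1) * ε ^ (-(ds / β))) * Real.exp (C * ε ^ (-(ds / β))) := by gcongr
    _ = _ := by rw [← Real.exp_add]; congr 1; ring

/-- Labelling the `K` inner components and the outer function separately, the inner error `δ` passes
through the Hölder modulus of one outer function, and the change of outer function adds `ε`. -/
theorem HasFinePartition.comp {G₁ : Set (Cube d → ℝ)} {G₂ : Set (Cube K → ℝ)}
    {δ ε C κ N₁ N₂ : ℝ} (hδ : 0 ≤ δ) (hκ : 0 ≤ κ) (hC : 0 ≤ C)
    (h₁ : HasFinePartition G₁ Set.univ δ N₁) (h₂ : HasFinePartition G₂ Set.univ ε N₂)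
    (hG₂ : ∀ g ∈ G₂, ∀ x z : Cube K, |g x - g z| ≤ C * ‖x.1 - z.1‖ ^ κ) :
    HasFinePartition {f | ∃ h : Cube d → Cube K, (∀ j : Fin K, (fun x => (h x).1 j) ∈ G₁) ∧
      ∃ g ∈ G₂, f = g ∘ h} Set.univ (C * δ ^ κ + ε) (N₁ ^ K * N₂) := by
  obtain ⟨ι₁, _, φ₁, hc₁, hφ₁⟩ := h₁
  obtain ⟨ι₂, _, φ₂, hc₂, hφ₂⟩ := h₂
  have hex : ∀ f : Cube d → ℝ, ∃ (h : Cube d → Cube K) (g : Cube K → ℝ),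
      (∃ h : Cube d → Cube K, (∀ j : Fin K, (fun x => (h x).1 j) ∈ G₁) ∧ ∃ g ∈ G₂, f = g ∘ h) →
      (∀ j : Fin K, (fun x => (h x).1 j) ∈ G₁) ∧ g ∈ G₂ ∧ f = g ∘ h := by
    intro f
    by_cases hf : ∃ h : Cube d → Cube K, (∀ j : Fin K, (fun x => (h x).1 j) ∈ G₁) ∧
        ∃ g ∈ G₂, f = g ∘ h
    · obtain ⟨h, hh, g, hg, hfg⟩ := hf
      exact ⟨h, g, fun _ => ⟨hh, hg, hfg⟩⟩
    · exact ⟨fun _ => ⟨0, by simp⟩, 0, fun h => absurd h hf⟩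
  choose h g hhg using hex
  refine ⟨(Fin K → ι₁) × ι₂, inferInstance,
    fun f => (fun j => φ₁ fun x => (h f x).1 j, φ₂ (g f)), ?_, fun f hf f' hf' hff' x _ => ?_⟩
  · rw [Fintype.card_prod, Fintype.card_fun]
    push_cast
    rw [Fintype.card_fin]
    have hN₁ : 0 ≤ N₁ := (Nat.cast_nonneg _).trans hc₁
    gcongr
  · simp only [Prod.mk.injEq] at hff'
    obtain ⟨a1, a2, a3⟩ := hhg f hf
    obtain ⟨b1, b2, b3⟩ := hhg f' hf'
    have e1 : ‖(h f x).1 - (h f' x).1‖ ≤ δ := by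
      rw [pi_norm_le_iff_of_nonneg hδ]
      exact fun j => hφ₁ _ (a1 j) _ (b1 j) (congrFun hff'.1 j) x (Set.mem_univ _)
    have e2 := hφ₂ _ a2 _ b2 hff'.2 (h f' x) (Set.mem_univ _)
    have e3 := hG₂ _ a2 (h f x) (h f' x)
    rw [a3, b3]
    calc |g f (h f x) - g f' (h f' x)|
        ≤ |g f (h f x) - g f (h f' x)| + |g f (h f' x) - g f' (h f' x)| := abs_sub_le _ _ _
      _ ≤ C * ‖(h f x).1 - (h f' x).1‖ ^ κ + ε := by gcongr
      _ ≤ _ := by gcongr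

theorem effSmooth_pos (hβ : 0 < β) : 0 < effSmooth β q :=
  mul_pos hβ (pow_pos (lt_min one_pos hβ) _)

/-- The metric entropy of the class of compositional functions. -/
theorem exists_classCHOM_partition (hds : 1 ≤ ds) (hβ : 0 < β) (hr : 0 < r) (q d : ℕ) :
    ∃ C : ℝ, 0 < C ∧ ∀ ε : ℝ, 0 < ε → ε ≤ 1 →
      HasFinePartition (classCHOM K dM ds β r q d) Set.univ ε
        (Real.exp (C * ε ^ (-(ds / effSmooth β q)))) := by
  have hγ : 0 < min 1 β := lt_min one_pos hβ
  induction q generalizing d with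
  | zero => simpa [classCHOM, effSmooth] using exists_component_partition hds hβ hr d
  | succ q ih =>
    obtain ⟨C₀, hC₀, h₀⟩ := exists_component_partition (dM := dM) hds hβ hr d
    obtain ⟨C₁, hC₁, h₁⟩ := ih K
    obtain ⟨C, hC, hHolder⟩ :=
      exists_holder_const_classCHOM (K := K) (dM := dM) (ds := ds) hβ hr q K
    -- `κ` is the Hölder exponent of the outer function. Inner precision `δ` with `C * δ ^ κ = ε /
    -- 2` has entropy of order `δ ^ (-ds / β)`, that is `ε ^ (-ds / (β κ))`; this dominates the
    -- outer entropy.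
    set κ := min 1 β ^ (q + 1) with hκ
    have hκ0 : 0 < κ := by positivity
    set a := (ds : ℝ) / effSmooth β (q + 1) with ha
    have haκ : a = ds / β / κ := by rw [ha, effSmooth, div_div]
    have haq : (ds : ℝ) / effSmooth β q ≤ a := by
      rw [ha]
      refine div_le_div_of_nonneg_left (by positivity) (effSmooth_pos hβ) ?_
      rw [effSmooth, effSmooth, pow_succ]
      gcongr
      exact mul_le_of_le_one_right (by positivity) (min_le_left _ _)
    refine ⟨K * (C₀ * (2 * C) ^ a) + C₁ * 2 ^ (ds / effSmooth β q), by positivity,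
      fun ε hε hε1 => ?_⟩
    set δ := (ε / (2 * C)) ^ (1 / κ) with hδ
    have hδ0 : 0 < δ := by positivity
    have hδ1 : δ ≤ 1 := Real.rpow_le_one (by positivity)
      ((div_le_one (by positivity)).2 (by linarith)) (by positivity)
    refine (HasFinePartition.comp hδ0.le hκ0.le (by linarith) (h₀ δ hδ0 hδ1)
      (h₁ (ε / 2) (by positivity) (by linarith)) hHolder).mono le_rfl le_rfl ?_ ?_
    · rw [hδ, ← Real.rpow_mul (by positivity), one_div_mul_cancel hκ0.ne', Real.rpow_one]
      apply le_of_eq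
      field_simp
      ring
    · rw [← Real.exp_nat_mul, ← Real.exp_add]
      refine Real.exp_le_exp.2 ?_
      have e1 : δ ^ (-(ds / β)) = (2 * C) ^ a * ε ^ (-a) := by
        rw [hδ, ← Real.rpow_mul (by positivity), show 1 / κ * -(ds / β) = -a by rw [haκ]; ring,
          Real.div_rpow hε.le (by positivity), Real.rpow_neg (by positivity : 0 ≤ 2 * C),
          div_inv_eq_mul, mul_comm]
      have e2 : (ε / 2) ^ (-(ds / effSmooth β q)) ≤ 2 ^ (ds / effSmooth β q) * ε ^ (-a) := by
        rw [Real.div_rpow hε.le zero_le_two, Real.rpow_neg zero_le_two, div_inv_eq_mul, mul_comm]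
        gcongr ?_ * ?_
        exact Real.rpow_le_rpow_of_exponent_ge hε hε1 (by linarith)
      rw [e1]
      calc _ ≤ K * (C₀ * ((2 * C) ^ a * ε ^ (-a))) +
            C₁ * (2 ^ (ds / effSmooth β q) * ε ^ (-a)) := by gcongr
        _ = _ := by ring

/-- One member is chosen from each nonempty class, which keeps the centres inside `G` at the same
radius. -/
theorem HasFinePartition.exists_net {X : Type} {G : Set (X → ℝ)} {ε N : ℝ}
    (h : HasFinePartition G Set.univ ε N) : ∃ (n : ℕ) (w : Fin n → X → ℝ), (n : ℝ) ≤ N ∧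
      (∀ i, w i ∈ G) ∧ ∀ f ∈ G, ∃ i, ∀ x, |f x - w i x| ≤ ε := by
  classical
  obtain ⟨ι, _, φ, hc, hφ⟩ := h
  let J := {a : ι // ∃ f ∈ G, φ f = a}
  let e := Fintype.equivFin J
  refine ⟨Fintype.card J, fun i => (e.symm i).2.choose, ?_, fun i => (e.symm i).2.choose_spec.1,
    fun f hf => ⟨e ⟨φ f, f, hf, rfl⟩, fun x => ?_⟩⟩
  · exact le_trans (by exact_mod_cast Fintype.card_subtype_le _) hc
  · refine hφ f hf _ (e.symm _).2.choose_spec.1 ?_ x (Set.mem_univ _)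
    rw [(e.symm _).2.choose_spec.2, Equiv.symm_apply_apply]

/-- A coordinate projection is a maximum over one coordinate; it serves in every layer. -/
theorem classCHOM_nonempty (hd : 1 ≤ d) (hK : 1 ≤ K) (hdM : 1 ≤ dM) :
    (classCHOM K dM ds β r q d).Nonempty := by
  have hproj : ∀ {d : ℕ} (i : Fin d), (fun x : Cube d => x.1 i) ∈ classM d dM := fun i =>
    ⟨{i}, Finset.singleton_nonempty i, by simpa using hdM, fun x => by simp⟩
  induction q generalizing d with
  | zero => exact ⟨_, Or.inr (hproj ⟨0, hd⟩)⟩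
  | succ q ih =>
    obtain ⟨g, hg⟩ := ih hK
    exact ⟨_, fun x => ⟨fun _ => x.1 ⟨0, hd⟩, restrict_mem_Icc x fun _ => ⟨0, hd⟩⟩,
      fun _ => Or.inr (hproj ⟨0, hd⟩), g, hg, rfl⟩

end Composition

/-! ### A risk bound for empirical risk minimization over a finite class -/

theorem exp_neg_le_one_sub_add_sq {x : ℝ} (hx : |x| ≤ 1) : Real.exp (-x) ≤ 1 - x + x ^ 2 := by
  have := Real.abs_exp_sub_one_sub_id_le (x := -x) (by rwa [abs_neg])
  rw [abs_le] at this
  nlinarith [this.2]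

section ERM

variable {Ω : Type} [MeasurableSpace Ω] {μ : Measure Ω} [IsProbabilityMeasure μ]

theorem integrable_of_abs_le_const {μ : Measure Ω} [IsFiniteMeasure μ] {Z : Ω → ℝ}
    (hZ : Measurable Z) {B : ℝ} (hb : ∀ ω, |Z ω| ≤ B) : Integrable Z μ :=
  Integrable.of_bound hZ.aestronglyMeasurable B (ae_of_all _ hb)

/-- A Bernstein-type bound: keeping the second moment, rather than the range of `Z`, lets the noise
condition act later. -/
theorem integral_exp_neg_le {Z : Ω → ℝ} (hZ : Measurable Z) (hZ1 : ∀ ω, |Z ω| ≤ 1) {lam : ℝ}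
    (h0 : 0 ≤ lam) (h1 : lam ≤ 1) :
    ∫ ω, Real.exp (-(lam * Z ω)) ∂μ ≤
      Real.exp (-(lam * ∫ ω, Z ω ∂μ) + lam ^ 2 * ∫ ω, Z ω ^ 2 ∂μ) := by
  have hZi : Integrable Z μ := integrable_of_abs_le_const hZ hZ1
  have hZ2 : Integrable (fun ω => Z ω ^ 2) μ :=
    integrable_of_abs_le_const (B := 1) (hZ.pow_const 2) fun ω => by
      rw [abs_pow]; exact pow_le_one₀ (abs_nonneg _) (hZ1 ω)
  have hlZ : ∀ ω, |lam * Z ω| ≤ 1 := fun ω => by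
    rw [abs_mul, abs_of_nonneg h0]
    exact mul_le_one₀ h1 (abs_nonneg _) (hZ1 ω)
  have hb : ∀ ω, Real.exp (-(lam * Z ω)) ≤ 1 - lam * Z ω + lam ^ 2 * Z ω ^ 2 := fun ω => by
    rw [← mul_pow]; exact exp_neg_le_one_sub_add_sq (hlZ ω)
  have hi1 : Integrable (fun ω => 1 - lam * Z ω) μ := (integrable_const 1).sub (hZi.const_mul lam)
  calc ∫ ω, Real.exp (-(lam * Z ω)) ∂μ
      ≤ ∫ ω, (1 - lam * Z ω + lam ^ 2 * Z ω ^ 2) ∂μ := by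
        refine integral_mono_of_nonneg (ae_of_all _ fun ω => (Real.exp_pos _).le)
          (hi1.add (hZ2.const_mul _)) (ae_of_all _ hb)
    _ = -(lam * ∫ ω, Z ω ∂μ) + lam ^ 2 * ∫ ω, Z ω ^ 2 ∂μ + 1 := by
        rw [integral_add hi1 (hZ2.const_mul _), integral_sub (integrable_const 1)
          (hZi.const_mul lam), integral_const_mul, integral_const_mul]
        simp; ring
    _ ≤ _ := Real.add_one_le_exp _

/-- The expected performance of an empirical minimizer over finitely many bounded functions. -/
theorem integral_erm_le {N n : ℕ} (hn : 1 ≤ n) {Z : Fin N → Ω → ℝ} (hZ : ∀ i, Measurable (Z i))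
    (hZ1 : ∀ i ω, |Z i ω| ≤ 1) {j : (Fin n → Ω) → Fin N} (hj : Measurable j)
    (hmin : ∀ D i, ∑ k, Z (j D) (D k) ≤ ∑ k, Z i (D k)) {lam : ℝ} (h0 : 0 ≤ lam) (h1 : lam ≤ 1)
    (i₀ : Fin N) :
    ∫ D, (lam * ∫ ω, Z (j D) ω ∂μ - lam ^ 2 * ∫ ω, Z (j D) ω ^ 2 ∂μ)
      ∂(Measure.pi fun _ : Fin n => μ) ≤ lam * ∫ ω, Z i₀ ω ∂μ + Real.log N / n := by
  set π := Measure.pi fun _ : Fin n => μ with hπ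
  set e : Fin N → ℝ := fun i => ∫ ω, Z i ω ∂μ with he
  set v : Fin N → ℝ := fun i => ∫ ω, Z i ω ^ 2 ∂μ with hv
  have hN : 0 < N := i₀.pos
  have hN0 : (0 : ℝ) < N := by exact_mod_cast hN
  have hn0 : (0 : ℝ) < n := by exact_mod_cast hn
  -- The compensation by the second moment is chosen so that `exp (T i)` has expectation at most
  -- one.
  set T : Fin N → (Fin n → Ω) → ℝ := fun i D =>
    n * (lam * e i) - lam * ∑ k, Z i (D k) - n * (lam ^ 2 * v i) with hT
  have hexpT : ∀ i, (fun D => Real.exp (T i D)) = fun D =>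
      Real.exp (n * (lam * e i) - n * (lam ^ 2 * v i)) *
        ∏ k, Real.exp (-(lam * Z i (D k))) := by
    intro i
    funext D
    rw [← Real.exp_sum, ← Real.exp_add, hT, Finset.sum_neg_distrib, ← Finset.mul_sum]
    congr 1; ring
  have hexpi : ∀ i, Integrable (fun D => Real.exp (T i D)) π := by
    intro i
    rw [hexpT i]
    refine Integrable.const_mul ?_ _
    refine Integrable.fintype_prod (μ := fun _ : Fin n => μ)
      (f := fun _ ω => Real.exp (-(lam * Z i ω))) fun _ => ?_
    refine integrable_of_abs_le_const (B := Real.exp 1)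
      (((hZ i).const_mul lam).neg.exp) fun ω => ?_
    rw [abs_of_pos (Real.exp_pos _)]
    refine Real.exp_le_exp.2 ((neg_le_abs _).trans ?_)
    rw [abs_mul, abs_of_nonneg h0]
    exact mul_le_one₀ h1 (abs_nonneg _) (hZ1 i ω)
  have hexp_le : ∀ i, ∫ D, Real.exp (T i D) ∂π ≤ 1 := by
    intro i
    rw [hexpT i, integral_const_mul, hπ,
      integral_fintype_prod_eq_pow (fun ω => Real.exp (-(lam * Z i ω))), Fintype.card_fin]
    calc _ ≤ Real.exp (n * (lam * e i) - n * (lam ^ 2 * v i)) *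
          Real.exp (-(lam * e i) + lam ^ 2 * v i) ^ n := by
          gcongr
          exact integral_exp_neg_le (hZ i) (hZ1 i) h0 h1
      _ = 1 := by
          rw [← Real.exp_nat_mul, ← Real.exp_add, Real.exp_eq_one_iff]
          ring
  have hmeas : ∀ i, Measurable fun D : Fin n → Ω => ∑ k, Z i (D k) := fun i =>
    Finset.measurable_sum _ fun k _ => (hZ i).comp (measurable_pi_apply k)
  have hSi : ∀ i k, Integrable (fun D : Fin n → Ω => Z i (D k)) π := fun i k =>
    integrable_of_abs_le_const ((hZ i).comp (measurable_pi_apply k)) fun D => hZ1 i (D k)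
  have hSint : ∫ D, ∑ k, Z i₀ (D k) ∂π = n * e i₀ := by
    rw [integral_finsetSum _ fun k _ => hSi i₀ k]
    have : ∀ k : Fin n, ∫ D, Z i₀ (D k) ∂π = e i₀ := fun k =>
      integral_comp_eval (μ := fun _ : Fin n => μ) (hZ i₀).aestronglyMeasurable
    simp [this]
  have hSii : Integrable (fun D => ∑ k, Z i₀ (D k)) π := integrable_finsetSum _ fun k _ => hSi i₀ k
  set R : (Fin n → Ω) → ℝ := fun D =>
    Real.log N - 1 + (N : ℝ)⁻¹ * ∑ i, Real.exp (T i D) + lam * ∑ k, Z i₀ (D k) with hR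
  have hi1 : Integrable (fun D => (N : ℝ)⁻¹ * ∑ i, Real.exp (T i D)) π :=
    (integrable_finsetSum _ fun i _ => hexpi i).const_mul _
  have hi2 : Integrable (fun D => Real.log N - 1 + (N : ℝ)⁻¹ * ∑ i, Real.exp (T i D)) π :=
    (integrable_const _).add hi1
  have hRi : Integrable R π := hi2.add (hSii.const_mul _)
  have hRint : ∫ D, R D ∂π ≤ Real.log N + n * (lam * e i₀) := by
    rw [hR, integral_add hi2 (hSii.const_mul _), integral_add (integrable_const _) hi1,
      integral_const_mul, integral_const_mul, hSint,
      integral_finsetSum _ fun i _ => hexpi i]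
    have : (N : ℝ)⁻¹ * ∑ i, ∫ D, Real.exp (T i D) ∂π ≤ 1 := by
      rw [inv_mul_le_iff₀ hN0]
      calc _ ≤ ∑ _i : Fin N, (1 : ℝ) := Finset.sum_le_sum fun i _ => hexp_le i
        _ = _ := by simp
    simp only [integral_const, probReal_univ, one_smul]
    linarith
  have hpt : ∀ D, n * (lam * e (j D) - lam ^ 2 * v (j D)) ≤ R D := by
    intro D
    -- A union bound in expectation: `1 + y ≤ exp y` at `y = T - log N`, with the exponential at the
    -- random index dominated by the sum over all indices.
    have a1 : T (j D) D ≤ Real.log N - 1 + (N : ℝ)⁻¹ * ∑ i, Real.exp (T i D) := by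
      have b1 := Real.add_one_le_exp (T (j D) D - Real.log N)
      rw [Real.exp_sub, Real.exp_log hN0, div_eq_inv_mul] at b1
      have b2 : Real.exp (T (j D) D) ≤ ∑ i, Real.exp (T i D) :=
        Finset.single_le_sum (f := fun i => Real.exp (T i D))
          (fun i _ => (Real.exp_pos _).le) (Finset.mem_univ (j D))
      have b3 : (N : ℝ)⁻¹ * Real.exp (T (j D) D) ≤ (N : ℝ)⁻¹ * ∑ i, Real.exp (T i D) := by
        gcongr
      linarith
    have a2 : lam * ∑ k, Z (j D) (D k) ≤ lam * ∑ k, Z i₀ (D k) :=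
      mul_le_mul_of_nonneg_left (hmin D i₀) h0
    have a3 : n * (lam * e (j D) - lam ^ 2 * v (j D)) =
        T (j D) D + lam * ∑ k, Z (j D) (D k) := by simp only [hT]; ring
    rw [a3]
    simp only [hR]
    linarith
  have hLi : Integrable (fun D => n * (lam * e (j D) - lam ^ 2 * v (j D))) π := by
    have hm : Measurable fun i : Fin N => (n : ℝ) * (lam * e i - lam ^ 2 * v i) :=
      measurable_of_finite _
    refine integrable_of_abs_le_const (hm.comp hj)
      (B := ∑ i, |(n : ℝ) * (lam * e i - lam ^ 2 * v i)|) fun D => ?_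
    exact Finset.single_le_sum (f := fun i => |(n : ℝ) * (lam * e i - lam ^ 2 * v i)|)
      (fun i _ => abs_nonneg _) (Finset.mem_univ (j D))
  have hfin := (integral_mono hLi hRi hpt).trans hRint
  rw [integral_const_mul] at hfin
  rw [← sub_le_iff_le_add', le_div_iff₀' hn0]
  linarith

end ERM

section Classification

variable {d : ℕ} {P : ProbabilityMeasure (Cube d × Label)}

/-! ### Excess risk -/

theorem sgn_of_nonneg {t : ℝ} (h : 0 ≤ t) : sgn t = 1 := if_pos h

theorem sgn_of_neg {t : ℝ} (h : t < 0) : sgn t = -1 := if_neg (not_le.2 h)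

theorem sgn_eq_or (t : ℝ) : sgn t = 1 ∨ sgn t = -1 := by
  unfold sgn; split_ifs <;> simp

theorem sgn_sgn (t : ℝ) : sgn (sgn t) = sgn t := by
  rcases sgn_eq_or t with h | h <;> rw [h] <;> norm_num [sgn]

theorem measurable_sgn : Measurable sgn :=
  Measurable.ite measurableSet_Ici measurable_const measurable_const

theorem label_eq_or (y : Label) : y.1 = 1 ∨ y.1 = -1 := by
  have h := y.2
  rw [Set.mem_insert_iff, Set.mem_singleton_iff] at h
  exact h.symm

/-- The inputs at which the plug-in rule of `g` differs from the Bayes rule. -/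
def disagree (P : ProbabilityMeasure (Cube d × Label)) (g : Cube d → ℝ) : Set (Cube d) :=
  {x | sgn (g x) ≠ sgn (2 * ccp P x - 1)}

theorem measurable_ccp : Measurable (ccp P) :=
  ((Kernel.measurable_coe _ (measurableSet_singleton _)).ennreal_toReal)

theorem ccp_nonneg (x : Cube d) : 0 ≤ ccp P x := measureReal_nonneg

theorem ccp_le_one (x : Cube d) : ccp P x ≤ 1 := measureReal_le_one

theorem measurable_bayes : Measurable fun x => 2 * ccp P x - 1 :=
  (measurable_ccp.const_mul 2).sub_const 1

theorem measurableSet_disagree {g : Cube d → ℝ} (hg : Measurable g) :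
    MeasurableSet (disagree P g) :=
  (measurableSet_eq_fun (measurable_sgn.comp hg) (measurable_sgn.comp measurable_bayes)).compl

theorem measurableSet_error {g : Cube d → ℝ} (hg : Measurable g) :
    MeasurableSet {z : Cube d × Label | sgn (g z.1) ≠ z.2.1} :=
  (measurableSet_eq_fun (measurable_sgn.comp (hg.comp measurable_fst))
    (measurable_subtype_coe.comp measurable_snd)).compl

theorem integrable_pointwise_risk {g : Cube d → ℝ} (hg : Measurable g) :
    Integrable (fun x => if 0 ≤ g x then 1 - ccp P x else ccp P x)
      (P : Measure (Cube d × Label)).fst := by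
  refine integrable_of_abs_le_const (B := 1) (Measurable.ite (measurableSet_le measurable_const hg)
    (measurable_const.sub measurable_ccp) measurable_ccp) fun x => ?_
  have h1 := ccp_nonneg (P := P) x
  have h2 := ccp_le_one (P := P) x
  split_ifs <;> rw [abs_le] <;> constructor <;> linarith

theorem risk_eq_integral {g : Cube d → ℝ} (hg : Measurable g) :
    risk P g = ∫ x, (if 0 ≤ g x then 1 - ccp P x else ccp P x)
      ∂(P : Measure (Cube d × Label)).fst := by
  set μ := (P : Measure (Cube d × Label)) with hμ
  have hslice : ∀ x, (μ.condKernel x).real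
      (Prod.mk x ⁻¹' {z : Cube d × Label | sgn (g z.1) ≠ z.2.1}) =
      if 0 ≤ g x then 1 - ccp P x else ccp P x := by
    intro x
    split_ifs with h
    · have : Prod.mk x ⁻¹' {z : Cube d × Label | sgn (g z.1) ≠ z.2.1} = {Label.one}ᶜ := by
        ext y
        simp [sgn_of_nonneg h, Label.one, Subtype.ext_iff, eq_comm]
      rw [this, probReal_compl_eq_one_sub (measurableSet_singleton _), ccp]
    · have : Prod.mk x ⁻¹' {z : Cube d × Label | sgn (g z.1) ≠ z.2.1} = {Label.one} := by
        ext y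
        simp only [Set.mem_preimage, Set.mem_ofPred_eq, Set.mem_singleton_iff, Subtype.ext_iff,
          Label.one, sgn_of_neg (not_le.1 h)]
        rcases label_eq_or y with hy | hy <;> rw [hy] <;> norm_num
      rw [this, ccp]
  rw [risk, measureReal_def, ← hμ]
  conv_lhs => rw [← μ.disintegrate μ.condKernel]
  rw [Measure.compProd_apply (measurableSet_error hg), ← integral_toReal]
  · exact integral_congr_ae (ae_of_all _ hslice)
  · exact (Kernel.measurable_kernel_prodMk_left (measurableSet_error hg)).aemeasurable
  · exact ae_of_all _ fun x => measure_lt_top _ _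

/-- Conditionally on `x`, the two error probabilities are `η` and `1 - η` in some order when the
rules disagree, and coincide otherwise. -/
theorem risk_sub_bayes_risk {g : Cube d → ℝ} (hg : Measurable g) :
    risk P g - risk P (fun x => 2 * ccp P x - 1) =
      ∫ x in disagree P g, |2 * ccp P x - 1| ∂(P : Measure (Cube d × Label)).fst := by
  rw [risk_eq_integral hg, risk_eq_integral measurable_bayes,
    ← integral_sub (integrable_pointwise_risk hg) (integrable_pointwise_risk measurable_bayes),
    ← integral_indicator (measurableSet_disagree hg)]
  refine integral_congr_ae (ae_of_all _ fun x => ?_)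
  have hmem : x ∈ disagree P g ↔ sgn (g x) ≠ sgn (2 * ccp P x - 1) := Iff.rfl
  dsimp only
  rcases le_or_gt 0 (g x) with h1 | h1 <;> rcases le_or_gt 0 (2 * ccp P x - 1) with h2 | h2
  · rw [Set.indicator_of_notMem (by rw [hmem, sgn_of_nonneg h1, sgn_of_nonneg h2]; simp),
      if_pos h1, if_pos h2, sub_self]
  · rw [Set.indicator_of_mem (by rw [hmem, sgn_of_nonneg h1, sgn_of_neg h2]; norm_num),
      if_pos h1, if_neg (not_le.2 h2), abs_of_neg h2]
    ring
  · rw [Set.indicator_of_mem (by rw [hmem, sgn_of_neg h1, sgn_of_nonneg h2]; norm_num),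
      if_neg (not_le.2 h1), if_pos h2, abs_of_nonneg h2]
    ring
  · rw [Set.indicator_of_notMem (by rw [hmem, sgn_of_neg h1, sgn_of_neg h2]; simp),
      if_neg (not_le.2 h1), if_neg (not_le.2 h2), sub_self]

theorem iInf_risk : ⨅ g : {g : Cube d → ℝ // Measurable g}, risk P g.1 =
    risk P (fun x => 2 * ccp P x - 1) := by
  have : Nonempty {g : Cube d → ℝ // Measurable g} := ⟨⟨_, measurable_bayes (P := P)⟩⟩
  refine le_antisymm (ciInf_le (f := fun g : {g : Cube d → ℝ // Measurable g} => risk P g.1)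
    ⟨0, ?_⟩ ⟨_, measurable_bayes⟩) (le_ciInf fun g => ?_)
  · rintro _ ⟨g, rfl⟩
    exact measureReal_nonneg
  · rw [← sub_nonneg, risk_sub_bayes_risk g.2]
    exact integral_nonneg fun x => abs_nonneg _

theorem excessRisk_eq {g : Cube d → ℝ} (hg : Measurable g) : excessRisk P g =
    ∫ x in disagree P g, |2 * ccp P x - 1| ∂(P : Measure (Cube d × Label)).fst := by
  rw [excessRisk, iInf_risk, risk_sub_bayes_risk hg]

/-! ### Consequences of the noise condition. -/

theorem integrable_abs_bayes : Integrable (fun x => |2 * ccp P x - 1|)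
    (P : Measure (Cube d × Label)).fst := by
  refine integrable_of_abs_le_const (B := 1) measurable_bayes.abs fun x => ?_
  have h1 := ccp_nonneg (P := P) x
  have h2 := ccp_le_one (P := P) x
  rw [abs_abs, abs_le]
  constructor <;> linarith

theorem measurableSet_noise (t : ℝ) : MeasurableSet {x | |2 * ccp P x - 1| ≤ t} :=
  measurableSet_le measurable_bayes.abs measurable_const

/-- The noise condition bounds the probability of disagreeing with the Bayes rule by the excess
risk. -/
theorem mul_disagree_le {g : Cube d → ℝ} (hg : Measurable g) {t a : ℝ} (ht : 0 ≤ t)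
    (ha : (P : Measure (Cube d × Label)).fst.real {x | |2 * ccp P x - 1| ≤ t} ≤ a) :
    t * (P : Measure (Cube d × Label)).fst.real (disagree P g) ≤ excessRisk P g + t * a := by
  set ν := (P : Measure (Cube d × Label)).fst
  set L : Set (Cube d) := {x | |2 * ccp P x - 1| ≤ t} with hL
  have hD := measurableSet_disagree (P := P) hg
  have hLm : MeasurableSet L := measurableSet_noise t
  -- Markov's inequality after removing the low-margin set: elsewhere each disagreement costs more
  -- than `t`.
  have h1 : ν.real (disagree P g) ≤ ν.real (disagree P g \ L) + a := by
    calc ν.real (disagree P g) ≤ ν.real (disagree P g \ L ∪ L) :=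
          measureReal_mono (by rw [Set.sdiff_union_self]; exact Set.subset_union_left)
      _ ≤ _ := (measureReal_union_le _ _).trans (by gcongr)
  have h2 : t * ν.real (disagree P g \ L) ≤ excessRisk P g := by
    rw [excessRisk_eq hg]
    calc t * ν.real (disagree P g \ L) = ∫ _x in disagree P g \ L, t ∂ν := by simp [mul_comm]
      _ ≤ ∫ x in disagree P g \ L, |2 * ccp P x - 1| ∂ν := by
          refine setIntegral_mono_on (integrable_const t) integrable_abs_bayes.integrableOn
            (hD.diff hLm) fun x hx => ?_
          exact (not_le.1 hx.2).le
      _ ≤ _ := setIntegral_mono_set integrable_abs_bayes.integrableOn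
          (ae_of_all _ fun x => abs_nonneg _) (Set.sdiff_subset.eventuallyLE)
  nlinarith

theorem excessRisk_le_of_forall {g : Cube d → ℝ} (hg : Measurable g) {t a : ℝ} (ht : 0 ≤ t)
    (ha : (P : Measure (Cube d × Label)).fst.real {x | |2 * ccp P x - 1| ≤ t} ≤ a)
    (h : ∀ᵐ x ∂(P : Measure (Cube d × Label)).fst, x ∈ disagree P g → |2 * ccp P x - 1| ≤ t) :
    excessRisk P g ≤ t * a := by
  set ν := (P : Measure (Cube d × Label)).fst
  rw [excessRisk_eq hg]
  have hLm : MeasurableSet {x | |2 * ccp P x - 1| ≤ t} := measurableSet_noise t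
  calc _ ≤ ∫ x in {x | |2 * ccp P x - 1| ≤ t}, |2 * ccp P x - 1| ∂ν :=
        setIntegral_mono_set integrable_abs_bayes.integrableOn
          (ae_of_all _ fun x => abs_nonneg _) h
    _ ≤ ∫ _x in {x | |2 * ccp P x - 1| ≤ t}, t ∂ν :=
        setIntegral_mono_on integrable_abs_bayes.integrableOn (integrable_const t) hLm
          fun x hx => hx
    _ = t * ν.real {x | |2 * ccp P x - 1| ≤ t} := by simp [mul_comm]
    _ ≤ t * a := by gcongr

/-- When the signs differ, zero lies between `2 * w x - 1` and `2 * ccp P x - 1`, which are at most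
`2 * ξ` apart. -/
theorem abs_bayes_le_of_mem_disagree {w : Cube d → ℝ} {x : Cube d} {ξ : ℝ}
    (h : |ccp P x - w x| ≤ ξ) (hx : x ∈ disagree P fun x => sgn (2 * w x - 1)) :
    |2 * ccp P x - 1| ≤ 2 * ξ := by
  simp only [disagree, Set.mem_ofPred_eq, sgn_sgn] at hx
  rw [abs_le] at h
  rcases le_or_gt 0 (2 * w x - 1) with h1 | h1 <;> rcases le_or_gt 0 (2 * ccp P x - 1) with h2 | h2
  · simp [sgn_of_nonneg h1, sgn_of_nonneg h2] at hx
  · rw [abs_of_neg h2]; linarith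
  · rw [abs_of_nonneg h2]; linarith
  · simp [sgn_of_neg h1, sgn_of_neg h2] at hx

/-! ### The relative 0-1 loss -/

/-- The 0-1 loss. -/
def zeroOneLoss (g : Cube d → ℝ) (z : Cube d × Label) : ℝ :=
  if sgn (g z.1) = z.2.1 then 0 else 1

theorem zeroOneLoss_eq_indicator (g : Cube d → ℝ) :
    zeroOneLoss g = Set.indicator {z : Cube d × Label | sgn (g z.1) ≠ z.2.1} 1 := by
  funext z
  by_cases h : sgn (g z.1) = z.2.1
  · rw [Set.indicator_of_notMem (by simpa using h), zeroOneLoss, if_pos h]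
  · rw [Set.indicator_of_mem (by simpa using h), zeroOneLoss, if_neg h, Pi.one_apply]

theorem measurable_zeroOneLoss {g : Cube d → ℝ} (hg : Measurable g) :
    Measurable (zeroOneLoss g) := by
  rw [zeroOneLoss_eq_indicator]
  exact measurable_one.indicator (measurableSet_error hg)

theorem abs_zeroOneLoss_le (g : Cube d → ℝ) (z : Cube d × Label) : |zeroOneLoss g z| ≤ 1 := by
  unfold zeroOneLoss
  split_ifs <;> simp

theorem integral_zeroOneLoss {g : Cube d → ℝ} (hg : Measurable g) :
    ∫ z, zeroOneLoss g z ∂(P : Measure (Cube d × Label)) = risk P g := by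
  rw [zeroOneLoss_eq_indicator, integral_indicator_one (measurableSet_error hg), risk]

/-- The 0-1 loss of `g` relative to that of the Bayes rule. -/
def relLoss (P : ProbabilityMeasure (Cube d × Label)) (g : Cube d → ℝ) (z : Cube d × Label) : ℝ :=
  zeroOneLoss g z - zeroOneLoss (fun x => 2 * ccp P x - 1) z

theorem measurable_relLoss {g : Cube d → ℝ} (hg : Measurable g) : Measurable (relLoss P g) :=
  (measurable_zeroOneLoss hg).sub (measurable_zeroOneLoss measurable_bayes)

theorem abs_relLoss_le (g : Cube d → ℝ) (z : Cube d × Label) : |relLoss P g z| ≤ 1 := by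
  unfold relLoss zeroOneLoss
  split_ifs <;> simp

theorem integral_relLoss {g : Cube d → ℝ} (hg : Measurable g) :
    ∫ z, relLoss P g z ∂(P : Measure (Cube d × Label)) = excessRisk P g := by
  simp only [relLoss]
  rw [integral_sub (integrable_of_abs_le_const (measurable_zeroOneLoss hg) (abs_zeroOneLoss_le g))
    (integrable_of_abs_le_const (measurable_zeroOneLoss measurable_bayes) (abs_zeroOneLoss_le _)),
    integral_zeroOneLoss hg, integral_zeroOneLoss measurable_bayes, excessRisk, iInf_risk]

/-- The relative loss is ±1 where the rules disagree, whatever the label, and 0 elsewhere. -/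
theorem integral_relLoss_sq {g : Cube d → ℝ} (hg : Measurable g) :
    ∫ z, relLoss P g z ^ 2 ∂(P : Measure (Cube d × Label)) =
      (P : Measure (Cube d × Label)).fst.real (disagree P g) := by
  have hD := measurableSet_disagree (P := P) hg
  have hsq : ∀ z, relLoss P g z ^ 2 = (Prod.fst ⁻¹' disagree P g).indicator 1 z := by
    intro z
    have hmem : z ∈ Prod.fst ⁻¹' disagree P g ↔ sgn (g z.1) ≠ sgn (2 * ccp P z.1 - 1) := Iff.rfl
    by_cases h : z ∈ Prod.fst ⁻¹' disagree P g
    · rw [Set.indicator_of_mem h, relLoss, zeroOneLoss, zeroOneLoss]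
      rw [hmem] at h
      rcases label_eq_or z.2 with h0 | h0 <;> rcases sgn_eq_or (g z.1) with h1 | h1 <;>
        rcases sgn_eq_or (2 * ccp P z.1 - 1) with h2 | h2 <;> rw [h1, h2] at h <;>
        rw [h0, h1, h2] <;> first | exact absurd rfl h | norm_num
    · rw [Set.indicator_of_notMem h, relLoss, zeroOneLoss, zeroOneLoss]
      rw [hmem, not_not] at h
      rw [h, sub_self, zero_pow two_ne_zero]
  simp only [hsq]
  rw [integral_indicator_one (measurable_fst hD), measureReal_def, measureReal_def,
    Measure.fst_apply hD]

/-! ### Reduction from hinge to 0-1 loss, and measurable selection of the minimizer. -/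

theorem hinge_mul_eq {f : Cube d → ℝ} (hf : ∀ x, sgn (f x) = f x) (z : Cube d × Label) :
    hinge (z.2.1 * f z.1) = 2 * zeroOneLoss f z := by
  rw [zeroOneLoss, hf, hinge]
  rcases label_eq_or z.2 with h | h <;> rcases sgn_eq_or (f z.1) with h1 | h1 <;>
    rw [hf] at h1 <;> rw [h, h1] <;> norm_num

/-- The Bayes loss is unknown to the estimator but enters both sums equally, so minimizing the hinge
risk also minimizes the relative loss. -/
theorem sum_relLoss_le_of_empHingeRisk_le {n : ℕ} (hn : 1 ≤ n) {f g : Cube d → ℝ}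
    (hf : ∀ x, sgn (f x) = f x) (hg : ∀ x, sgn (g x) = g x) {D : Fin n → Cube d × Label}
    (h : empHingeRisk D f ≤ empHingeRisk D g) :
    ∑ k, relLoss P f (D k) ≤ ∑ k, relLoss P g (D k) := by
  have hn0 : (0 : ℝ) < n := by exact_mod_cast hn
  unfold empHingeRisk at h
  have h := le_of_mul_le_mul_left h (by positivity)
  simp only [hinge_mul_eq hf, hinge_mul_eq hg, ← Finset.mul_sum] at h
  simp only [relLoss, Finset.sum_sub_distrib]
  linarith

theorem measurable_empHingeRisk {n : ℕ} {f : Cube d → ℝ} (hf : Measurable f) :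
    Measurable fun D : Fin n → Cube d × Label => empHingeRisk D f := by
  refine Measurable.const_mul (Finset.measurable_sum _ fun i _ => ?_) _
  refine Measurable.max measurable_const (measurable_const.sub ?_)
  exact (measurable_subtype_coe.comp (measurable_snd.comp (measurable_pi_apply i))).mul
    (hf.comp (measurable_fst.comp (measurable_pi_apply i)))

/-- Among finitely many real-valued measurable functions, the index of a smallest one can be chosen
measurably. -/
theorem exists_measurable_argmin {Ω : Type} [MeasurableSpace Ω] {N : ℕ} (hN : 0 < N)
    {R : Fin N → Ω → ℝ} (hR : ∀ i, Measurable (R i)) :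
    ∃ j : Ω → Fin N, Measurable j ∧ ∀ ω i, R (j ω) ω ≤ R i ω := by
  classical
  have : Nonempty (Fin N) := ⟨⟨0, hN⟩⟩
  -- Ties are broken by the least index, which makes the selection measurable.
  let p : Ω → ℕ → Prop := fun ω k => ∃ h : k < N, ∀ i, R ⟨k, h⟩ ω ≤ R i ω
  have hp : ∀ ω, ∃ k, p ω k := fun ω => by
    obtain ⟨i, hi⟩ := Finite.exists_min fun i => R i ω
    exact ⟨i, i.2, hi⟩
  have hm : ∀ k, MeasurableSet {ω | p ω k} := fun k => by
    by_cases h : k < N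
    · have : {ω | p ω k} = ⋂ i, {ω | R ⟨k, h⟩ ω ≤ R i ω} := by
        ext ω
        simp [p, h]
      rw [this]
      exact MeasurableSet.iInter fun i => measurableSet_le (hR _) (hR i)
    · have : {ω | p ω k} = ∅ := by
        ext ω
        simp [p, h]
      rw [this]
      exact MeasurableSet.empty
  have hfind := measurable_find hp hm
  refine ⟨fun ω => ⟨Nat.find (hp ω), (Nat.find_spec (hp ω)).1⟩, ?_, fun ω i =>
    (Nat.find_spec (hp ω)).2 i⟩
  refine measurable_to_countable' fun i => ?_
  have := hfind (measurableSet_singleton i.1)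
  convert this using 1
  ext ω
  simp [Fin.ext_iff]

/-- The risk bound for a plug-in empirical hinge risk minimizer over finitely many functions. -/
theorem integral_excessRisk_le {N n : ℕ} (hn : 1 ≤ n) {w : Fin N → Cube d → ℝ}
    (hw : ∀ i, Measurable (w i)) {j : (Fin n → Cube d × Label) → Fin N} (hj : Measurable j)
    (hmin : ∀ D i, empHingeRisk D (fun x => sgn (2 * w (j D) x - 1)) ≤
      empHingeRisk D (fun x => sgn (2 * w i x - 1))) {ξ a : ℝ} (hξ : 0 < ξ) (hξ1 : ξ ≤ 1)
    (ha : (P : Measure (Cube d × Label)).fst.real {x | |2 * ccp P x - 1| ≤ 2 * ξ} ≤ a)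
    (hnet : ∃ i, ∀ᵐ x ∂(P : Measure (Cube d × Label)).fst, |ccp P x - w i x| ≤ ξ) :
    Integrable (fun D => excessRisk P fun x => sgn (2 * w (j D) x - 1))
        (Measure.pi fun _ : Fin n => (P : Measure (Cube d × Label))) ∧
      ∫ D, (excessRisk P fun x => sgn (2 * w (j D) x - 1))
        ∂(Measure.pi fun _ : Fin n => (P : Measure (Cube d × Label))) ≤
      3 * (2 * ξ * a) + 2 * (Real.log N / (ξ * n)) := by
  set π := Measure.pi fun _ : Fin n => (P : Measure (Cube d × Label)) with hπ
  set f : Fin N → Cube d → ℝ := fun i x => sgn (2 * w i x - 1) with hf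
  have hfm : ∀ i, Measurable (f i) := fun i =>
    measurable_sgn.comp (((hw i).const_mul 2).sub_const 1)
  have hn0 : (0 : ℝ) < n := by exact_mod_cast hn
  obtain ⟨i₀, hi₀⟩ := hnet
  have hbias : excessRisk P (f i₀) ≤ 2 * ξ * a := by
    refine excessRisk_le_of_forall (hfm i₀) (by positivity) ha ?_
    filter_upwards [hi₀] with x hx hx'
    exact abs_bayes_le_of_mem_disagree hx hx'
  have hbd : ∀ F : Fin N → ℝ, Integrable (fun D => F (j D)) π := by
    intro F
    refine integrable_of_abs_le_const ((measurable_of_finite F).comp hj)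
      (B := ∑ i, |F i|) fun D => ?_
    exact Finset.single_le_sum (f := fun i => |F i|) (fun i _ => abs_nonneg _)
      (Finset.mem_univ (j D))
  have hE : Integrable (fun D => excessRisk P (f (j D))) π := hbd fun i => excessRisk P (f i)
  refine ⟨hE, ?_⟩
  have herm := integral_erm_le (μ := (P : Measure (Cube d × Label))) hn
    (Z := fun i => relLoss P (f i)) (fun i => measurable_relLoss (hfm i))
    (fun i => abs_relLoss_le (f i)) hj (fun D i => sum_relLoss_le_of_empHingeRisk_le hn
      (fun x => sgn_sgn _) (fun x => sgn_sgn _) (hmin D i)) hξ.le hξ1 i₀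
  simp only [integral_relLoss (hfm _), integral_relLoss_sq (hfm _)] at herm
  -- With `lam = ξ` and margin `t = 2 * ξ`, the variance term consumes exactly half of the linear
  -- term.
  have hpt : ∀ i, ξ / 2 * excessRisk P (f i) - ξ / 2 * (2 * ξ * a) ≤ ξ * excessRisk P (f i) -
      ξ ^ 2 * (P : Measure (Cube d × Label)).fst.real (disagree P (f i)) := by
    intro i
    have := mul_disagree_le (hfm i) (by positivity) ha
    nlinarith
  have hint : ∫ D, (ξ / 2 * excessRisk P (f (j D)) - ξ / 2 * (2 * ξ * a)) ∂π ≤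
      ξ * excessRisk P (f i₀) + Real.log N / n := by
    refine (integral_mono (hbd fun i => ξ / 2 * excessRisk P (f i) - ξ / 2 * (2 * ξ * a))
      (hbd fun i => ξ * excessRisk P (f i) -
        ξ ^ 2 * (P : Measure (Cube d × Label)).fst.real (disagree P (f i)))
      fun D => hpt (j D)).trans herm
  rw [integral_sub (hE.const_mul _) (integrable_const _), integral_const_mul] at hint
  simp only [integral_const, probReal_univ, one_smul] at hint
  have h1 : ξ * excessRisk P (f i₀) ≤ ξ * (2 * ξ * a) := by gcongr
  have h2 : ξ / 2 * ∫ D, excessRisk P (f (j D)) ∂π ≤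
      ξ / 2 * (3 * (2 * ξ * a) + 2 * (Real.log N / (ξ * n))) := by
    have : ξ / 2 * (3 * (2 * ξ * a) + 2 * (Real.log N / (ξ * n))) =
        ξ / 2 * (2 * ξ * a) + ξ * (2 * ξ * a) + Real.log N / n := by
      field_simp; ring
    linarith
  exact le_of_mul_le_mul_left h2 (by positivity)

end Classification

/-! ### Exponents -/

theorem toReal_inv_add_add {s : ℝ≥0∞} (hs : s ≠ ∞) {b c : ℝ} (hb : 0 ≤ b) (hc : 0 ≤ c) :
    ((s + ENNReal.ofReal b + ENNReal.ofReal c)⁻¹).toReal = (s.toReal + b + c)⁻¹ := by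
  rw [ENNReal.toReal_inv, ENNReal.toReal_add (by finiteness) (by finiteness),
    ENNReal.toReal_add hs (by finiteness), ENNReal.toReal_ofReal hb, ENNReal.toReal_ofReal hc]

/-- The exponent of `1 / n` in the net width. -/
def widthExp (β : ℝ) (q ds : ℕ) (s : ℝ≥0∞) : ℝ :=
  ((s + 2 + ENNReal.ofReal (ds / effSmooth β q))⁻¹).toReal

theorem widthExp_nonneg (β : ℝ) (q ds : ℕ) (s : ℝ≥0∞) : 0 ≤ widthExp β q ds s :=
  ENNReal.toReal_nonneg

theorem widthExp_top (β : ℝ) (q ds : ℕ) : widthExp β q ds ∞ = 0 := by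
  simp [widthExp]

theorem widthExp_of_ne_top {β : ℝ} (hβ : 0 < β) (q ds : ℕ) {s : ℝ≥0∞} (hs : s ≠ ∞) :
    widthExp β q ds s = (s.toReal + 2 + ds / effSmooth β q)⁻¹ := by
  have := effSmooth_pos (q := q) hβ
  rw [widthExp, ← toReal_inv_add_add hs zero_le_two (by positivity)]
  simp

theorem rateExp_top {β : ℝ} (hβ : 0 < β) (q ds : ℕ) : rateExp β q ds ∞ = 1 := by
  simp [rateExp, (effSmooth_pos (q := q) hβ).ne']

theorem rateExp_of_ne_top {β : ℝ} (hβ : 0 < β) (q ds : ℕ) {s : ℝ≥0∞} (hs : s ≠ ∞) :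
    rateExp β q ds s = widthExp β q ds s * (s.toReal + 1) := by
  have h := effSmooth_pos (q := q) hβ
  have hs0 : 0 ≤ s.toReal := ENNReal.toReal_nonneg
  have h1 : ((s + 1)⁻¹).toReal = (s.toReal + 1)⁻¹ := by
    rw [ENNReal.toReal_inv, ENNReal.toReal_add hs ENNReal.one_ne_top, ENNReal.toReal_one]
  rw [widthExp_of_ne_top hβ q ds hs, rateExp, h1]
  have h2 : 0 < s.toReal + 2 + ds / effSmooth β q := by positivity
  have h3 : 0 < ds * (s.toReal + 1)⁻¹ + (1 + (s.toReal + 1)⁻¹) * effSmooth β q := by positivity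
  rw [inv_mul_eq_div, div_eq_div_iff h3.ne' h2.ne']
  field_simp
  ring

/-- With `rateExp_of_ne_top` this is the balance of errors: the bias `ξ ^ (s + 1)` and the entropy
term `ξ ^ (-b - 1) / n` have the same order. -/
theorem rateExp_eq_one_sub {β : ℝ} (hβ : 0 < β) (q ds : ℕ) (s : ℝ≥0∞) :
    rateExp β q ds s = 1 - widthExp β q ds s * (ds / effSmooth β q + 1) := by
  by_cases hs : s = ∞
  · rw [hs, rateExp_top hβ, widthExp_top, zero_mul, sub_zero]
  · have h := effSmooth_pos (q := q) hβ
    have hs0 : 0 ≤ s.toReal := ENNReal.toReal_nonneg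
    have h2 : 0 < s.toReal + 2 + ds / effSmooth β q := by positivity
    rw [rateExp_of_ne_top hβ q ds hs, widthExp_of_ne_top hβ q ds hs]
    rw [eq_sub_iff_add_eq, ← mul_add, inv_mul_eq_one₀ h2.ne']
    ring

/-- The stochastic error of the estimator is of the order of the convergence rate. -/
theorem entropy_term_eq {β : ℝ} (hβ : 0 < β) (q ds : ℕ) (s : ℝ≥0∞) {T : ℝ} (hT : 0 < T) {n : ℕ}
    (hn : 1 ≤ n) {C : ℝ} :
    C * (T * (1 / (n : ℝ)) ^ widthExp β q ds s) ^ (-(ds / effSmooth β q)) /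
      (T * (1 / (n : ℝ)) ^ widthExp β q ds s * n) =
      C * T ^ (-(ds / effSmooth β q)) / T * (1 / (n : ℝ)) ^ rateExp β q ds s := by
  have hn0 : (0 : ℝ) < n := by exact_mod_cast hn
  have hx : (0 : ℝ) < 1 / n := by positivity
  set x := 1 / (n : ℝ) with hxdef
  have hnx : (n : ℝ) = x⁻¹ := by rw [hxdef, one_div, inv_inv]
  rw [rateExp_eq_one_sub hβ, Real.rpow_sub hx, Real.rpow_one, mul_add, Real.rpow_add hx, mul_one,
    Real.mul_rpow hT.le (by positivity), ← Real.rpow_mul hx.le, mul_neg, Real.rpow_neg hx.le, hnx]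
  field_simp

/-- The noise condition at level `t ≤ x ^ widthExp` yields a bias of the order of the convergence
rate. -/
theorem noise_term_le {β : ℝ} (hβ : 0 < β) (q ds : ℕ) (s : ℝ≥0∞) {α t : ℝ} (hα : 0 < α)
    (ht : 0 < t) (ht1 : t < 1) {n : ℕ} (hn : 1 ≤ n)
    (htn : t ≤ (1 / (n : ℝ)) ^ widthExp β q ds s) :
    t * (ENNReal.ofReal α * extPow t s).toReal ≤ α * (1 / (n : ℝ)) ^ rateExp β q ds s := by
  have hn0 : (0 : ℝ) < n := by exact_mod_cast hn
  unfold extPow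
  by_cases hs : s = ∞
  · rw [if_pos hs, if_pos ht1]
    simp only [mul_zero, ENNReal.toReal_zero]
    positivity
  · have hs0 : 0 ≤ s.toReal := ENNReal.toReal_nonneg
    rw [if_neg hs, ENNReal.toReal_mul, ENNReal.toReal_ofReal hα.le,
      ENNReal.toReal_ofReal (by positivity), rateExp_of_ne_top hβ q ds hs,
      Real.rpow_mul (by positivity)]
    calc t * (α * t ^ s.toReal) = α * t ^ (s.toReal + 1) := by
          rw [Real.rpow_add ht, Real.rpow_one]; ring
      _ ≤ _ := by gcongr

/-- Finiteness is what lets the noise bound pass to real numbers, since `toReal` sends `∞` to 0. -/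
theorem extPow_ne_top {t : ℝ} (ht : t < 1) (s : ℝ≥0∞) : extPow t s ≠ ∞ := by
  unfold extPow
  split_ifs <;> simp

theorem measurable_uncurry_select {Ω X : Type} [MeasurableSpace Ω] [MeasurableSpace X] {N : ℕ}
    {j : Ω → Fin N} (hj : Measurable j) {f : Fin N → X → ℝ} (hf : ∀ i, Measurable (f i)) :
    Measurable (Function.uncurry fun ω => f (j ω)) := by
  have h : Measurable fun p : Fin N × X => f p.1 p.2 := measurable_from_prod_countable_right hf
  exact h.comp ((hj.comp measurable_fst).prodMk measurable_snd)

end CompClassif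

end

/-! ### Choice of the net and conclusion. -/

theorem theorem3p3 (d q K dM ds : ℕ) (β r α : ℝ) (τ : ℝ≥0∞)
    (hd : 1 ≤ d) (hK : 1 ≤ K) (hdM : 1 ≤ dM) (hds : 1 ≤ ds)
    (hβ : 0 < β) (hr : 0 < r) (hα : 0 < α) (hτ : 0 < τ)
    (hdsd : ds ≤ d) (hdsK : ds * q ≤ K * q) (hατ : ¬ (α < 1 ∧ 1 ≤ τ)) :
    ∃ c : ℝ, 0 < c ∧ ∀ n : ℕ, 1 ≤ n → ∀ s : ℝ≥0∞,
      ∃ (W : Set (CompClassif.Cube d → ℝ))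
        (fhat : (Fin n → CompClassif.Cube d × CompClassif.Label) → CompClassif.Cube d → ℝ),
        CompClassif.IsFiniteNet W (CompClassif.classCHOM K dM ds β r q d)
          (CompClassif.netWidth β q ds s τ n) ∧
        CompClassif.IsHingeERM (CompClassif.plugIn W) fhat ∧
        Measurable (Function.uncurry fhat) ∧
        ∀ P ∈ CompClassif.compModel d q K dM ds β r ∩ CompClassif.noiseModel d s α τ,
          Integrable (fun D => CompClassif.excessRisk P (fhat D))
            (Measure.pi fun _ : Fin n =>
              (P : Measure (CompClassif.Cube d × CompClassif.Label))) ∧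
          ∫ D, CompClassif.excessRisk P (fhat D)
            ∂(Measure.pi fun _ : Fin n =>
              (P : Measure (CompClassif.Cube d × CompClassif.Label)))
            ≤ c * (1 / (n : ℝ)) ^ CompClassif.rateExp β q ds s := by
  obtain ⟨C, hC, hpart⟩ := CompClassif.exists_classCHOM_partition (K := K) (dM := dM) hds hβ hr q d
  set b := (ds : ℝ) / CompClassif.effSmooth β q with hb
  have hτ1 : min τ 1 ≠ ∞ := ((min_le_right τ 1).trans_lt ENNReal.one_lt_top).ne
  set T := (min τ 1).toReal with hT
  have hT0 : 0 < T := ENNReal.toReal_pos (lt_min hτ one_pos).ne' hτ1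
  have hT1 : T ≤ 1 := ENNReal.toReal_le_of_le_ofReal zero_le_one (by simp)
  refine ⟨3 * α + 2 * (C * (T / 3) ^ (-b) / (T / 3)), by positivity, fun n hn s => ?_⟩
  have hn0 : (0 : ℝ) < n := by exact_mod_cast hn
  set u := (1 / (n : ℝ)) ^ CompClassif.widthExp β q ds s with hu
  have hu0 : 0 < u := by positivity
  have hu1 : u ≤ 1 := Real.rpow_le_one (by positivity)
    ((div_le_one hn0).2 (by exact_mod_cast hn)) (CompClassif.widthExp_nonneg _ _ _ _)
  have hξ : CompClassif.netWidth β q ds s τ n = T / 3 * u := rfl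
  rw [hξ]
  set ξ := T / 3 * u with hξdef
  have hξ0 : 0 < ξ := by positivity
  -- The factor `1 / 3` in the width puts `2 * ξ` below `τ`, where the noise condition holds, and
  -- strictly below 1, where `extPow` vanishes for `s = ∞`. By the next line also `2 * ξ ≤ u`, so
  -- `(2 * ξ) ^ (s + 1) ≤ u ^ (s + 1)` with no constant depending on `s`.
  have hξT : 3 * ξ ≤ T := by nlinarith
  have hξu : 3 * ξ ≤ u := by nlinarith
  obtain ⟨N, w, hN, hwG, hnet⟩ := (hpart ξ hξ0 (by linarith)).exists_net
  have hwm : ∀ i, Measurable (w i) := fun i =>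
    (CompClassif.continuous_of_mem_classCHOM hβ hr (hwG i)).measurable
  have hN0 : 0 < N := by
    obtain ⟨f, hf⟩ := CompClassif.classCHOM_nonempty (q := q) (K := K) (ds := ds) (β := β) (r := r)
      hd hK hdM
    exact (hnet f hf).choose.pos
  have hfm : ∀ i, Measurable fun x => CompClassif.sgn (2 * w i x - 1) := fun i =>
    CompClassif.measurable_sgn.comp (((hwm i).const_mul 2).sub_const 1)
  have hRm : ∀ i, Measurable fun D : Fin n → CompClassif.Cube d × CompClassif.Label =>
      CompClassif.empHingeRisk D fun x => CompClassif.sgn (2 * w i x - 1) :=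
    fun i => CompClassif.measurable_empHingeRisk (hfm i)
  obtain ⟨j, hj, hjmin⟩ := CompClassif.exists_measurable_argmin hN0 hRm
  refine ⟨Set.range w, fun D x => CompClassif.sgn (2 * w (j D) x - 1),
    ⟨Set.finite_range w, Set.range_subset_iff.2 hwG, fun f hf => ?_⟩, fun D => ⟨?_, ?_⟩,
    CompClassif.measurable_uncurry_select hj hfm, fun P hP => ?_⟩
  · obtain ⟨i, hi⟩ := hnet f hf
    exact ⟨w i, Set.mem_range_self i, hi⟩
  · exact Set.mem_image_of_mem _ (Set.mem_range_self (j D))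
  · rintro _ ⟨_, ⟨i, rfl⟩, rfl⟩
    exact hjmin D i
  · obtain ⟨⟨η, hη, hPη⟩, hnoise⟩ := hP
    obtain ⟨i, hi⟩ := hnet η hη
    have ht1 : 2 * ξ < 1 := by linarith
    have hmass := hnoise (2 * ξ) (by positivity) (by
      refine (ENNReal.ofReal_le_of_le_toReal ?_).trans (min_le_left τ 1)
      linarith)
    have hmass' : (P : Measure (CompClassif.Cube d × CompClassif.Label)).fst.real
        {x | |2 * CompClassif.ccp P x - 1| ≤ 2 * ξ} ≤
          (ENNReal.ofReal α * CompClassif.extPow (2 * ξ) s).toReal :=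
      ENNReal.toReal_mono (ENNReal.mul_ne_top ENNReal.ofReal_ne_top
        (CompClassif.extPow_ne_top ht1 s)) hmass
    have hclose : ∀ᵐ x ∂(P : Measure (CompClassif.Cube d × CompClassif.Label)).fst,
        |CompClassif.ccp P x - w i x| ≤ ξ := by
      filter_upwards [hPη] with x hx
      rw [hx]
      exact hi x
    have hξ1 : ξ ≤ 1 := by linarith
    obtain ⟨hint, hle⟩ := CompClassif.integral_excessRisk_le (P := P) hn hwm hj
      (fun D i => hjmin D i) hξ0 hξ1 hmass' ⟨i, hclose⟩
    refine ⟨hint, hle.trans ?_⟩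
    have h1 := CompClassif.noise_term_le hβ q ds s hα (by positivity) ht1 hn
      (by linarith : 2 * ξ ≤ u)
    have hlog : Real.log N ≤ C * ξ ^ (-b) := by
      rw [Real.log_le_iff_le_exp (by exact_mod_cast hN0)]
      exact hN
    have h2 : Real.log N / (ξ * n) ≤ C * ξ ^ (-b) / (ξ * n) := by gcongr
    rw [hξdef, hu, hb, CompClassif.entropy_term_eq hβ q ds s (by positivity) hn] at h2
    rw [add_mul]
    have h3 : 2 * (Real.log N / (ξ * n)) ≤ 2 * (C * (T / 3) ^ (-b) / (T / 3)) *
        (1 / (n : ℝ)) ^ CompClassif.rateExp β q ds s := by linarith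
    linarith
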